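/- Let $d\in\mathbb{N}$, $d\ge 1$, and let $\mathbb{T}^d=(\mathbb{R}/2\pi\mathbb{Z})^d$ carry the normalised measure $(2\pi)^{-d}\,dx$. For $f\in L_1(\mathbb{T}^d)$ put $\hat f(k)=(2\pi)^{-d}\int_{\mathbb{T}^d}f(x)e^{-ik\cdot x}\,dx$, $k\in\mathbb{Z}^d$. For $0<s<\infty$ and $0<r\le\infty$ let $$\omega_{s,r}(k)=\prod_{i=1}^d(1+|k_i|^r)^{s/r}\quad(r<\infty),\qquad \omega_{s,\infty}(k)=\prod_{i=1}^d\max(1,|k_i|)^s ,$$ let $\mathcal{A}^{s,r}_{\mathrm{mix}}(\mathbb{T}^d)$ be the class of all $f\in L_1(\mathbb{T}^d)$ with $\|f\|_{\mathcal{A}^{s,r}_{\mathrm{mix}}}=\sum_{k\in\mathbb{Z}^d}\omega_{s,r}(k)|\hat f(k)|<\infty$, and let $\mathcal{A}(\mathbb{T}^d)$ be the Wiener algebra of all $f\in L_1(\mathbb{T}^d)$ with $\|f\|_{\mathcal{A}}=\sum_{k\in\mathbb{Z}^d}|\hat f(k)|<\infty$. For $Y=L_2(\mathbb{T}^d)$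 or $Y=\mathcal{A}(\mathbb{T}^d)$ let $$\sigma_n\big(id:\mathcal{A}^{s,r}_{\mathrm{mix}}(\mathbb{T}^d)\to Y,\mathcal{T}^d\big)=\sup_{\|f\|_{\mathcal{A}^{s,r}_{\mathrm{mix}}}\le 1}\ \inf_{a_1,\dots,a_n\in\mathbb{C},\ k^{1},\dots,k^{n}\in\mathbb{Z}^d}\Big\|f-\sum_{j=1}^n a_j e^{ik^{j}\cdot x}\Big\|_Y$$ be the best $n$-term approximation width with respect to the trigonometric system $\mathcal{T}^d=\{e^{ik\cdot x}:k\in\mathbb{Z}^d\}$. Then for all $0<s<\infty$ and $0<r\le\infty$ these widths are finite, and $$\lim_{n\to\infty}\frac{\sigma_n\big(id:\mathcal{A}^{s,r}_{\mathrm{mix}}(\mathbb{T}^d)\to L_2(\mathbb{T}^d),\mathcal{T}^d\big)}{n^{-s-\frac12}(\ln n)^{s(d-1)}}=\frac{(s+\frac12)^{s+\frac12}}{\sqrt2\,(s+1)^s}\Big(\frac{2^d}{(d-1)!}\Big)^s$$ and $$\lim_{n\to\infty}\frac{\sigma_n\big(id:\mathcal{A}^{s,r}_{\mathrm{mix}}(\mathbb{T}^d)\to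 \mathcal{A}(\mathbb{T}^d),\mathcal{T}^d\big)}{n^{-s}(\ln n)^{s(d-1)}}=\frac{s^s}{(s+1)^s}\Big(\frac{2^d}{(d-1)!}\Big)^s .$$ -/

import Mathlib

open Filter MeasureTheory
open scoped Topology ENNReal

namespace MixWiener

noncomputable section

instance fact_two_pi_pos : Fact (0 < 2 * Real.pi) := ⟨Real.two_pi_pos⟩

/-- The `d`-dimensional torus `𝕋^d`, `𝕋 = ℝ / 2πℤ`. -/
abbrev Torus (d : ℕ) : Type := Fin d → AddCircle (2 * Real.pi)

/-- The normalised measure `(2π)^{-d} dx` on `𝕋^d` (a probability measure). -/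
abbrev torusMeasure (d : ℕ) : Measure (Torus d) :=
  Measure.pi fun _ => AddCircle.haarAddCircle

/-- The space `L_1(𝕋^d)`; all function classes below are subspaces of it. -/
abbrev L1 (d : ℕ) : Type := Lp ℂ 1 (torusMeasure d)

/-- The character `x ↦ e^{i k·x} = ∏ᵢ e^{i kᵢ xᵢ}` as a continuous function on `𝕋^d`. -/
def char {d : ℕ} (k : Fin d → ℤ) : C(Torus d, ℂ) where
  toFun x := ∏ i, fourier (k i) (x i)
  continuous_toFun := by fun_prop

/-- The character `e^{i k·x}` as an element of `L_1(𝕋^d)`. -/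
def charL1 {d : ℕ} (k : Fin d → ℤ) : L1 d :=
  ContinuousMap.toLp 1 (torusMeasure d) ℂ (char k)

/-- The trigonometric system `{e^{i k·x} : k ∈ ℤ^d}`. -/
def trigSystem (d : ℕ) : Set (L1 d) := Set.range charL1

/-- The Fourier coefficient `f̂(k) = (2π)^{-d} ∫ f(x) e^{-i k·x} dx`. -/
def fourierCoeffTorus {d : ℕ} (f : L1 d) (k : Fin d → ℤ) : ℂ :=
  ∫ x, f x * char (-k) x ∂torusMeasure d

/-- The (quasi-)norm `(∑_k |ω(k) f̂(k)|^p)^{1/p}`, `0 < p < ∞`, of the weighted class `F_{ω,p}(𝕋^d)`,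
with values in `[0, ∞]`; the class consists of the `f ∈ L_1(𝕋^d)` for which it is finite. -/
def normF {d : ℕ} (ω : (Fin d → ℤ) → ℝ) (p : ℝ) (f : L1 d) : ℝ≥0∞ :=
  (∑' k, ‖(ω k : ℂ) * fourierCoeffTorus f k‖ₑ ^ p) ^ (1 / p)

/-- The weights `∏ᵢ (1 + |kᵢ|^r)^{s/r}` for `0 < r < ∞`, and `∏ᵢ max(1, |kᵢ|)^s` for `r = ∞`. -/
def mixWeight {d : ℕ} (s : ℝ) (r : ℝ≥0∞) (k : Fin d → ℤ) : ℝ :=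
  if r = ∞ then ∏ i, (max 1 |(k i : ℝ)|) ^ s
  else ∏ i, (1 + |(k i : ℝ)| ^ r.toReal) ^ (s / r.toReal)

/-- The norm of the weighted Wiener class `𝒜^{s,r}_mix(𝕋^d)` (`∞` off the class). -/
def normAmix {d : ℕ} (s : ℝ) (r : ℝ≥0∞) (f : L1 d) : ℝ≥0∞ := normF (mixWeight s r) 1 f

/-- The norm of the Wiener algebra `𝒜(𝕋^d)` (`∞` off the algebra). -/
def normA {d : ℕ} (f : L1 d) : ℝ≥0∞ := normF (fun _ => 1) 1 f

/-- The norm of `L_2(𝕋^d)` (`∞` off the space). -/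
def normL2 {d : ℕ} (f : L1 d) : ℝ≥0∞ := eLpNorm f 2 (torusMeasure d)

/-- The error `σ_n(y; D)` of best `n`-term approximation of `y` by the dictionary `D`, measured in
the extended norm `normY`. -/
def nTermError {V : Type*} [AddCommGroup V] [Module ℂ V] (normY : V → ℝ≥0∞) (D : Set V) (n : ℕ)
    (y : V) : ℝ≥0∞ :=
  ⨅ (a : Fin n → ℂ) (g : Fin n → D), normY (y - ∑ j, a j • (g j : V))

/-- The best `n`-term approximation width `σ_n(id : X → Y, D)`, where `X` and `Y` are the spaces of
those `x ∈ V` for which the extended norms `normX` and `normY`, respectively, are finite. -/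
def nTermWidth {V : Type*} [AddCommGroup V] [Module ℂ V] (normX normY : V → ℝ≥0∞) (D : Set V)
    (n : ℕ) : ℝ≥0∞ :=
  ⨆ (x : V) (_ : normX x ≤ 1), nTermError normY D n x

end

end MixWiener

/-! The problem is one about sequences. An `L_1` function is determined by its Fourier coefficients,
and both target norms are `ℓ_p` norms of these coefficients: `p = 1` by definition, `p = 2` by
Parseval, which applies because the weights are at least `1` and the coefficients are therefore
summable. Write `β = 1/p`, and let `W m` be the smallest total weight of `m` frequencies. The
`n`-term width is then `sup_{m > n} (m - n)^β / W m`.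

For the lower bound (`le_nTermWidth`), take a constant sequence on a cheapest set of `m`
frequencies: `n` terms alter at most `n` of its entries. For the upper bound
(`exists_finset_eLpNorm_le`), a nonnegative finite sequence is peeled into constant layers on nested
sets; each layer obeys the bound, and the triangle inequality adds the bounds up.

It remains to find `W` and to optimise. Each weight is the `s`-th power of a product of coordinate
sizes `ρ(k_i)` with `ρ(k) ~ |k|`, which is why `r` leaves no trace in the limit. With `d = D + 1`
and `c = 2^d / D!`, the hyperbolic cross `∏ ρ(k_i) ≤ x` has `~ c x (log x)^D` points
(`IsSize.isEquivalent_card_hypCross`). Inverting, the `i`-th smallest product is `~ i / (c (log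
i)^D)`; raising to the power `s` and summing gives `W m ~ m^(s+1) (log m)^(-sD) / (c^s (s+1))`.
Putting `m = t n` reduces the supremum to maximising `(t - 1)^β / t^(s+1)`, whose maximum is
`maxConst β (s + 1)`. The delicate point is uniformity in `m`, where `log m` and `log n` need not be
comparable; see `rpow_sub_le_maxConst`. -/

namespace MixWiener

/-! ### Density of trigonometric polynomials and the Hilbert basis of characters -/

section Characters

open ComplexConjugate

variable {d : ℕ}

lemma char_neg (k : Fin d → ℤ) (x : Torus d) : char (-k) x = conj (char k x) := by
  simp only [char, Pi.neg_apply, fourier_neg, ContinuousMap.coe_mk, map_prod]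

lemma char_add (k l : Fin d → ℤ) (x : Torus d) : char (k + l) x = char k x * char l x := by
  simp only [char, Pi.add_apply, fourier_add, ContinuousMap.coe_mk, ← Finset.prod_mul_distrib]

lemma char_zero (x : Torus d) : char (0 : Fin d → ℤ) x = 1 := by
  simp [char]

lemma norm_char_apply (k : Fin d → ℤ) (x : Torus d) : ‖char k x‖ = 1 := by
  simp only [char, fourier_apply, ContinuousMap.coe_mk, norm_prod, Circle.norm_coe,
    Finset.prod_const_one]

lemma norm_char_le (k : Fin d → ℤ) : ‖(char k : C(Torus d, ℂ))‖ ≤ 1 :=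
  (ContinuousMap.norm_le _ zero_le_one).mpr fun x => (norm_char_apply k x).le

lemma char_single (x : Torus d) (i : Fin d) : char (Pi.single i 1) x = fourier 1 (x i) := by
  simp_rw [char, ContinuousMap.coe_mk]
  rw [Finset.prod_eq_single i]
  · simp
  · intro j _ hj
    rw [Pi.single_eq_of_ne hj, fourier_zero]
  · simp

/-- The star subalgebra of `C(𝕋^d, ℂ)` generated by the characters. -/
noncomputable def charSubalgebra (d : ℕ) : StarSubalgebra ℂ C(Torus d, ℂ) where
  toSubalgebra := Algebra.adjoin ℂ (Set.range char)
  star_mem' := by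
    change Algebra.adjoin ℂ (Set.range char) ≤ star (Algebra.adjoin ℂ (Set.range char))
    refine Algebra.adjoin_le ?_
    rintro _ ⟨n, rfl⟩
    refine Algebra.subset_adjoin ⟨-n, ?_⟩
    ext1 x
    simp only [char_neg, starRingEnd_apply, ContinuousMap.star_apply]

/-- The characters are closed under multiplication and contain `1`, so the algebra they generate is
no larger than their span. -/
theorem charSubalgebra_coe :
    Subalgebra.toSubmodule (charSubalgebra d).toSubalgebra = Submodule.span ℂ (Set.range char) := by
  apply Algebra.adjoin_eq_span_of_subset
  refine .trans (fun x ↦ Submonoid.closure_induction (fun _ ↦ id) ⟨0, ?_⟩ ?_)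
    Submodule.subset_span
  · ext z
    simp [char_zero]
  · rintro _ _ _ _ ⟨m, rfl⟩ ⟨n, rfl⟩
    exact ⟨m + n, by ext z; simp [char_add]⟩

theorem charSubalgebra_separatesPoints : (charSubalgebra d).SeparatesPoints := by
  intro x y hxy
  rw [Ne, funext_iff, not_forall] at hxy
  obtain ⟨i, hi⟩ := hxy
  refine ⟨_, ⟨char (Pi.single i 1), Algebra.subset_adjoin ⟨Pi.single i 1, rfl⟩, rfl⟩, ?_⟩
  dsimp only
  rw [char_single, char_single, fourier_one, fourier_one]
  exact fun h => hi (AddCircle.injective_toCircle Real.two_pi_pos.ne' (Subtype.ext h))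

/-- Stone–Weierstrass: two distinct points differ in some coordinate, and the character of that unit
frequency separates them. -/
theorem span_char_closure_eq_top :
    (Submodule.span ℂ (Set.range (char (d := d)))).topologicalClosure = ⊤ := by
  rw [← charSubalgebra_coe]
  exact congr_arg (Subalgebra.toSubmodule <| StarSubalgebra.toSubalgebra ·)
    (ContinuousMap.starSubalgebra_topologicalClosure_eq_top_of_separatesPoints _
      charSubalgebra_separatesPoints)

lemma integral_char (k : Fin d → ℤ) :
    ∫ x, char k x ∂torusMeasure d = if k = 0 then 1 else 0 := by
  split_ifs with h
  · simp [h, char_zero]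
  · simp only [char, ContinuousMap.coe_mk]
    rw [MeasureTheory.integral_fintype_prod_eq_prod]
    obtain ⟨i, hi⟩ := Function.ne_iff.mp h
    apply Finset.prod_eq_zero (Finset.mem_univ i)
    have := (orthonormal_iff_ite.mp (orthonormal_fourier (T := 2 * Real.pi))) 0 (k i)
    rw [if_neg (show (0 : ℤ) ≠ k i from Ne.symm hi)] at this
    simpa only [ContinuousMap.inner_toLp, fourier_zero, map_one, mul_one] using! this

/-- The characters as elements of `L_2(𝕋^d)`. -/
noncomputable def charL2 (k : Fin d → ℤ) : Lp ℂ 2 (torusMeasure d) :=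
  ContinuousMap.toLp 2 (torusMeasure d) ℂ (char k)

theorem orthonormal_charL2 : Orthonormal ℂ (charL2 (d := d)) := by
  rw [orthonormal_iff_ite]
  intro m n
  simp only [charL2, ContinuousMap.inner_toLp, ← char_neg, ← char_add, integral_char]
  congr 1
  rw [eq_iff_iff, add_neg_eq_zero, eq_comm]

theorem span_charL2_closure_eq_top :
    (Submodule.span ℂ (Set.range (charL2 (d := d)))).topologicalClosure = ⊤ := by
  simpa only [Submodule.map_span, ContinuousLinearMap.coe_coe, ← Set.range_comp,
    Function.comp_def] using!
    (ContinuousMap.toLp_denseRange ℂ (torusMeasure d) ℂ (p := 2)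
      (by simp)).topologicalClosure_map_submodule span_char_closure_eq_top

/-- The characters form a Hilbert basis of `L_2(𝕋^d)`. -/
noncomputable def charBasis (d : ℕ) : HilbertBasis (Fin d → ℤ) ℂ (Lp ℂ 2 (torusMeasure d)) :=
  HilbertBasis.mk orthonormal_charL2 span_charL2_closure_eq_top.ge

theorem charBasis_repr (f : Lp ℂ 2 (torusMeasure d)) (k : Fin d → ℤ) :
    (charBasis d).repr f k = ∫ x, f x * char (-k) x ∂torusMeasure d := by
  trans ∫ t, conj (charL2 k t) * f t ∂torusMeasure d
  · rw [(charBasis d).repr_apply_apply f k, MeasureTheory.L2.inner_def, charBasis,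
      HilbertBasis.coe_mk]
    simp only [RCLike.inner_apply, mul_comm]
  · apply integral_congr_ae
    filter_upwards [ContinuousMap.coeFn_toLp (𝕜 := ℂ) (p := 2) (torusMeasure d) (char k)] with _ ht
    rw [charL2, ht, ← char_neg, mul_comm]

end Characters

/-! ### Uniqueness of Fourier coefficients and Parseval's identity -/

section Uniqueness

variable {d : ℕ}

lemma integrable_coe (f : L1 d) : Integrable f (torusMeasure d) := L1.integrable_coeFn f

lemma integrable_mul_continuous (f : L1 d) (g : C(Torus d, ℂ)) :
    Integrable (fun x => f x * g x) (torusMeasure d) :=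
  (integrable_coe f).mul_bdd (c := ‖g‖) g.continuous.aestronglyMeasurable
    (Eventually.of_forall fun x => g.norm_coe_le_norm x)

/-- Integration against `f ∈ L_1(𝕋^d)` as a bounded functional on `C(𝕋^d)`. -/
noncomputable def pairing (f : L1 d) : C(Torus d, ℂ) →L[ℂ] ℂ :=
  LinearMap.mkContinuous
    { toFun := fun g => ∫ x, f x * g x ∂torusMeasure d
      map_add' := fun g h => by
        simp only [ContinuousMap.add_apply, mul_add]
        exact integral_add (integrable_mul_continuous f g) (integrable_mul_continuous f h)
      map_smul' := fun c g => by
        simp only [ContinuousMap.smul_apply, smul_eq_mul, RingHom.id_apply,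
          ← integral_const_mul]
        congr 1 with x
        ring }
    (∫ x, ‖f x‖ ∂torusMeasure d) fun g => by
      refine (norm_integral_le_integral_norm _).trans ?_
      rw [← integral_mul_const]
      refine integral_mono (integrable_mul_continuous f g).norm
        ((integrable_coe f).norm.mul_const _) fun x => ?_
      simp only [norm_mul]
      gcongr
      exact g.norm_coe_le_norm x

lemma pairing_apply (f : L1 d) (g : C(Torus d, ℂ)) :
    pairing f g = ∫ x, f x * g x ∂torusMeasure d := rfl

lemma fourierCoeffTorus_eq_pairing (f : L1 d) (k : Fin d → ℤ) :
    fourierCoeffTorus f k = pairing f (char (-k)) := rfl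

/-- A sup-norm continuous functional that vanishes on the characters vanishes on their closed span,
which is everything. -/
lemma pairing_eq_zero {f : L1 d} (hf : ∀ k, fourierCoeffTorus f k = 0) : pairing f = 0 := by
  have h : Submodule.span ℂ (Set.range (char (d := d))) ≤ (pairing f).ker := by
    rw [Submodule.span_le]
    rintro _ ⟨k, rfl⟩
    have := hf (-k)
    rw [fourierCoeffTorus_eq_pairing, neg_neg] at this
    exact this
  have h2 := Submodule.topologicalClosure_minimal _ h (pairing f).isClosed_ker
  rw [span_char_closure_eq_top, top_le_iff] at h2
  ext g
  have : g ∈ (pairing f).ker := by rw [h2]; trivial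
  exact this

/-- A function in `L_1(𝕋^d)` is determined by its Fourier coefficients. -/
theorem eq_zero_of_fourierCoeffTorus_eq_zero {f : L1 d} (hf : ∀ k, fourierCoeffTorus f k = 0) :
    f = 0 := by
  rw [Lp.eq_zero_iff_ae_eq_zero]
  -- Integrals over closed sets suffice: the indicator of `F` is a pointwise limit of continuous
  -- functions bounded by `1`, so dominated convergence carries over the vanishing of `pairing f`.
  refine ae_eq_zero_of_forall_setIntegral_isClosed_eq_zero (integrable_coe f) fun F hF => ?_
  rw [← integral_indicator hF.measurableSet]
  let g : ℕ → C(Torus d, ℂ) := fun n =>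
    ⟨fun x => ((hF.apprSeq n x : ℝ) : ℂ), by fun_prop⟩
  have h0 : ∀ n, ∫ x, f x * g n x ∂torusMeasure d = 0 := fun n => by
    rw [← pairing_apply, pairing_eq_zero hf]; rfl
  refine tendsto_nhds_unique (f := fun n => ∫ x, f x * g n x ∂torusMeasure d) (l := atTop) ?_
    (by simp only [h0]; exact tendsto_const_nhds)
  refine tendsto_integral_of_dominated_convergence (fun x => ‖f x‖)
    (fun n => (integrable_mul_continuous f (g n)).1) (integrable_coe f).norm
    (fun n => Eventually.of_forall fun x => ?_) (Eventually.of_forall fun x => ?_)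
  · rw [norm_mul]
    refine mul_le_of_le_one_right (norm_nonneg _) ?_
    have := HasOuterApproxClosed.apprSeq_apply_le_one hF n x
    simpa [g] using this
  · have h1 := tendsto_pi_nhds.1 (HasOuterApproxClosed.tendsto_apprSeq hF) x
    have h2 : Tendsto (fun n => g n x) atTop
        (𝓝 (((F.indicator (fun _ => (1 : NNReal)) x : NNReal) : ℝ) : ℂ)) :=
      (Complex.continuous_ofReal.tendsto _).comp ((NNReal.continuous_coe.tendsto _).comp h1)
    convert! h2.const_mul (f x) using 2
    by_cases hx : x ∈ F <;> simp [hx]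

lemma fourierCoeffTorus_toLp (g : C(Torus d, ℂ)) (k : Fin d → ℤ) :
    fourierCoeffTorus (ContinuousMap.toLp 1 (torusMeasure d) ℂ g) k =
      ∫ x, g x * char (-k) x ∂torusMeasure d := by
  refine integral_congr_ae ?_
  filter_upwards [ContinuousMap.coeFn_toLp (𝕜 := ℂ) (p := 1) (torusMeasure d) g] with x hx
  rw [hx]

lemma fourierCoeffTorus_charL1 (l k : Fin d → ℤ) :
    fourierCoeffTorus (charL1 l) k = if l = k then 1 else 0 := by
  rw [charL1, fourierCoeffTorus_toLp]
  simp only [← char_add, integral_char, ← sub_eq_add_neg, sub_eq_zero]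

/-- The `k`-th Fourier coefficient as a linear functional on `L_1(𝕋^d)`. -/
noncomputable def coeffHom (k : Fin d → ℤ) : L1 d →ₗ[ℂ] ℂ where
  toFun f := fourierCoeffTorus f k
  map_add' f g := by
    rw [fourierCoeffTorus, fourierCoeffTorus, fourierCoeffTorus,
      ← integral_add (integrable_mul_continuous f _) (integrable_mul_continuous g _)]
    refine integral_congr_ae ?_
    filter_upwards [Lp.coeFn_add f g] with x hx
    rw [hx, Pi.add_apply, add_mul]
  map_smul' c f := by
    rw [fourierCoeffTorus, fourierCoeffTorus, RingHom.id_apply, smul_eq_mul, ← integral_const_mul]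
    refine integral_congr_ae ?_
    filter_upwards [Lp.coeFn_smul c f] with x hx
    rw [hx, Pi.smul_apply, smul_eq_mul, mul_assoc]

lemma coeffHom_apply (k : Fin d → ℤ) (f : L1 d) : coeffHom k f = fourierCoeffTorus f k := rfl

/-- An `L_1` function with summable Fourier coefficients has a continuous representative. -/
lemma exists_continuous_of_summable {f : L1 d} (hf : Summable fun k => ‖fourierCoeffTorus f k‖) :
    ∃ g : C(Torus d, ℂ), ContinuousMap.toLp 1 (torusMeasure d) ℂ g = f := by
  have hs : Summable fun k => fourierCoeffTorus f k • (char k : C(Torus d, ℂ)) := by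
    refine Summable.of_norm_bounded hf fun k => ?_
    rw [norm_smul]
    exact mul_le_of_le_one_right (norm_nonneg _) (norm_char_le k)
  refine ⟨∑' k, fourierCoeffTorus f k • (char k : C(Torus d, ℂ)), ?_⟩
  rw [← sub_eq_zero]
  refine eq_zero_of_fourierCoeffTorus_eq_zero fun l => ?_
  rw [← coeffHom_apply, map_sub, sub_eq_zero, coeffHom_apply, coeffHom_apply,
    fourierCoeffTorus_toLp]
  -- The `l`-th coefficient of a continuous `g` is the pairing of `e^{-il·x}` with `g`. This is
  -- sup-norm continuous in `g`, so it may be taken termwise in the uniformly convergent series.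
  have h1 := (hs.hasSum.mapL (pairing (charL1 (-l)))).tsum_eq
  have h2 : ∀ g : C(Torus d, ℂ), pairing (charL1 (-l)) g =
      ∫ x, g x * char (-l) x ∂torusMeasure d := fun g => by
    rw [pairing_apply]
    refine integral_congr_ae ?_
    filter_upwards [ContinuousMap.coeFn_toLp (𝕜 := ℂ) (p := 1) (torusMeasure d)
      (char (-l))] with x hx
    rw [charL1, hx, mul_comm]
  rw [← h2, ← h1]
  have h3 : ∀ k, pairing (charL1 (-l)) (fourierCoeffTorus f k • char k) =
      if k = l then fourierCoeffTorus f l else 0 := fun k => by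
    rw [map_smul, h2]
    simp only [← char_add, integral_char, ← sub_eq_add_neg, sub_eq_zero]
    split_ifs with h <;> simp [h]
  simp only [h3, tsum_ite_eq]

/-- Parseval's identity for `L_1` functions with summable Fourier coefficients. -/
theorem normL2_eq_eLpNorm_count {f : L1 d} (hf : Summable fun k => ‖fourierCoeffTorus f k‖) :
    normL2 f = eLpNorm (fourierCoeffTorus f) 2 Measure.count := by
  obtain ⟨g, rfl⟩ := exists_continuous_of_summable hf
  set G := ContinuousMap.toLp 2 (torusMeasure d) ℂ g
  have h1 : normL2 (ContinuousMap.toLp 1 (torusMeasure d) ℂ g) = ‖G‖ₑ := by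
    rw [Lp.enorm_def, normL2]
    refine eLpNorm_congr_ae ?_
    filter_upwards [ContinuousMap.coeFn_toLp (𝕜 := ℂ) (p := 1) (torusMeasure d) g,
      ContinuousMap.coeFn_toLp (𝕜 := ℂ) (p := 2) (torusMeasure d) g] with x hx hx2
    rw [hx, hx2]
  have h2 : ∀ k, (charBasis d).repr G k =
      fourierCoeffTorus (ContinuousMap.toLp 1 (torusMeasure d) ℂ g) k := fun k => by
    rw [charBasis_repr, fourierCoeffTorus_toLp]
    refine integral_congr_ae ?_
    filter_upwards [ContinuousMap.coeFn_toLp (𝕜 := ℂ) (p := 2) (torusMeasure d) g] with x hx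
    rw [hx]
  have h3 : ‖G‖ₑ = ‖(charBasis d).repr G‖ₑ := by
    rw [← ofReal_norm, ← ofReal_norm, LinearIsometryEquiv.norm_map]
  rw [h1, h3, eLpNorm_eq_lintegral_rpow_enorm_toReal (by simp) (by simp), lintegral_count,
    ← ofReal_norm, lp.norm_eq_tsum_rpow (by simp),
    ← ENNReal.ofReal_rpow_of_nonneg (tsum_nonneg fun k => by positivity) (by simp),
    ENNReal.ofReal_tsum_of_nonneg (fun k => by positivity)
      ((lp.memℓp ((charBasis d).repr G)).summable (by simp))]
  congr 1
  refine tsum_congr fun k => ?_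
  rw [h2, ← ENNReal.ofReal_rpow_of_nonneg (norm_nonneg _) (by simp), ofReal_norm]

lemma normA_eq_eLpNorm_count (f : L1 d) :
    normA f = eLpNorm (fourierCoeffTorus f) 1 Measure.count := by
  rw [eLpNorm_one_eq_lintegral_enorm, lintegral_count]
  simp [normA, normF]

end Uniqueness

/-! ### Greedy approximation in sequence spaces -/

section SequenceSpace

variable {K : Type*} [MeasurableSpace K] [MeasurableSingletonClass K]

lemma eLpNorm_indicator_const_count {E : Type*} [NormedAddCommGroup E] (A : Finset K) (c : E)
    {p : ℝ≥0∞} (hp : 1 ≤ p) (hp' : p ≠ ∞) :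
    eLpNorm ((A : Set K).indicator fun _ => c) p Measure.count =
      ‖c‖ₑ * (A.card : ℝ≥0∞) ^ (1 / p.toReal) := by
  rw [eLpNorm_indicator_const A.measurableSet (by positivity) hp', Measure.count_apply_finset]

/-- Factor `x^p = x · x^(p-1)` and bound each second factor by the whole `ℓ_1` sum. -/
lemma eLpNorm_count_le_tsum (a : K → ℂ) {p : ℝ≥0∞} (hp : 1 ≤ p) (hp' : p ≠ ∞) :
    eLpNorm a p Measure.count ≤ ∑' k, ‖a k‖ₑ := by
  have hp0 : 1 ≤ p.toReal := by
    rw [← ENNReal.toReal_one]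
    exact ENNReal.toReal_mono hp' hp
  rw [eLpNorm_eq_lintegral_rpow_enorm_toReal (by positivity) hp', lintegral_count, one_div,
    ENNReal.rpow_inv_le_iff (by linarith)]
  have key : ∀ x : ℝ≥0∞, x ^ p.toReal = x * x ^ (p.toReal - 1) := fun x => by
    conv_lhs => rw [show p.toReal = 1 + (p.toReal - 1) by ring]
    rw [ENNReal.rpow_add_of_nonneg _ _ zero_le_one (by linarith), ENNReal.rpow_one]
  rw [key (∑' k, _), ← ENNReal.tsum_mul_right]
  refine ENNReal.tsum_le_tsum fun k => ?_
  rw [key]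
  exact mul_le_mul_right (ENNReal.rpow_le_rpow (ENNReal.le_tsum k) (by linarith)) _

variable [Countable K]

/-- Greedy `n`-term approximation of finitely supported nonnegative sequences. -/
lemma exists_finset_eLpNorm_le {w : K → ℝ} (hw : ∀ k, 0 ≤ w k) {W : ℕ → ℝ}
    (hW : ∀ A : Finset K, W A.card ≤ ∑ k ∈ A, w k) {p : ℝ≥0∞} (hp : 1 ≤ p) (hp' : p ≠ ∞)
    {n : ℕ} {R : ℝ} (hR : 0 ≤ R)
    (h : ∀ m : ℕ, n < m → ((m : ℝ) - n) ^ (1 / p.toReal) ≤ R * W m)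
    (F : Finset K) (b : K → ℝ) (hb : ∀ k ∈ F, 0 ≤ b k) :
    ∃ A ⊆ F, A.card = min n F.card ∧
      eLpNorm ((↑F \ ↑A : Set K).indicator b) p Measure.count ≤
        ENNReal.ofReal (R * ∑ k ∈ F, w k * b k) := by
  classical
  induction hN : F.card generalizing F b with
  | zero =>
    rw [Finset.card_eq_zero] at hN
    subst hN
    exact ⟨∅, by simp, by simp, by simp⟩
  | succ N ih =>
    rcases le_or_gt (N + 1) n with hn | hn
    · exact ⟨F, subset_rfl, by omega, by simp⟩
    -- Peel off the constant layer of height `b k₀`, the smallest entry. What remains vanishes at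
    -- `k₀`, so the induction applies to `F.erase k₀`; the layer costs `b k₀ * (|F| - n)^(1/p)`,
    -- controlled by the hypothesis at `m = |F|`.
    obtain ⟨k₀, hk₀, hmin⟩ := F.exists_min_image b (Finset.card_pos.1 (by omega))
    have hm : 0 ≤ b k₀ := hb k₀ hk₀
    obtain ⟨A, hAF, hA, hle⟩ := ih (F.erase k₀) (fun k => b k - b k₀)
      (fun k hk => sub_nonneg.2 (hmin k (Finset.mem_of_mem_erase hk)))
      (by rw [Finset.card_erase_of_mem hk₀, hN]; rfl)
    have hAF' : A ⊆ F := hAF.trans (Finset.erase_subset _ _)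
    have hAn : A.card = n := by omega
    refine ⟨A, hAF', by omega, ?_⟩
    have hsplit : ((↑F \ ↑A : Set K).indicator b) =
        ((↑(F.erase k₀) \ ↑A : Set K).indicator fun k => b k - b k₀) +
          ((↑(F \ A) : Set K).indicator fun _ => b k₀) := by
      ext k
      have hk₀A : k₀ ∉ A := fun hk => by simpa using hAF hk
      by_cases hk : k = k₀
      · subst hk
        simp [hk₀, hk₀A]
      · by_cases hkA : k ∈ A <;> by_cases hkF : k ∈ F <;> simp [hk, hkA, hkF]
    rw [hsplit]
    refine (eLpNorm_add_le (by fun_prop) (by fun_prop) hp).trans ?_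
    have hflat : eLpNorm ((↑(F \ A) : Set K).indicator fun _ => b k₀) p Measure.count ≤
        ENNReal.ofReal (R * ∑ k ∈ F, w k * b k₀) := by
      rw [eLpNorm_indicator_const_count _ _ hp hp', Finset.card_sdiff_of_subset hAF', hN, hAn,
        Real.enorm_eq_ofReal hm]
      have h1 : ((N + 1 - n : ℕ) : ℝ≥0∞) = ENNReal.ofReal (((N + 1 : ℕ) : ℝ) - n) := by
        rw [← Nat.cast_sub hn.le, ENNReal.ofReal_natCast]
      have h2 : (0 : ℝ) ≤ ((N + 1 : ℕ) : ℝ) - n := by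
        rw [← Nat.cast_sub hn.le]; positivity
      rw [h1, ENNReal.ofReal_rpow_of_nonneg h2 (by positivity), ← ENNReal.ofReal_mul hm]
      refine ENNReal.ofReal_le_ofReal ?_
      calc b k₀ * (((N + 1 : ℕ) : ℝ) - n) ^ (1 / p.toReal)
          ≤ b k₀ * (R * ∑ k ∈ F, w k) := by
            gcongr
            refine (h _ hn).trans ?_
            gcongr
            rw [← hN]
            exact hW F
        _ = _ := by rw [← Finset.sum_mul]; ring
    refine (add_le_add hle hflat).trans ?_
    rw [← ENNReal.ofReal_add]
    · refine ENNReal.ofReal_le_ofReal ?_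
      rw [← mul_add]
      gcongr
      have : ∑ k ∈ F.erase k₀, w k * (b k - b k₀) = ∑ k ∈ F, w k * (b k - b k₀) := by
        rw [← Finset.add_sum_erase F _ hk₀]; simp
      rw [this, ← Finset.sum_add_distrib]
      exact (Finset.sum_congr rfl fun k _ => by ring).le
    · refine mul_nonneg hR (Finset.sum_nonneg fun k hk => mul_nonneg (hw k) ?_)
      exact sub_nonneg.2 (hmin k (Finset.mem_of_mem_erase hk))
    · exact mul_nonneg hR (Finset.sum_nonneg fun k hk => mul_nonneg (hw k) hm)

/-- Greedy `n`-term approximation of sequences in the unit ball of weighted `ℓ_1`. -/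
lemma exists_finset_eLpNorm_compl_le {w : K → ℝ} (hw : ∀ k, 1 ≤ w k) {W : ℕ → ℝ}
    (hW : ∀ A : Finset K, W A.card ≤ ∑ k ∈ A, w k) {p : ℝ≥0∞} (hp : 1 ≤ p) (hp' : p ≠ ∞)
    {n : ℕ} {R : ℝ} (hR : 0 ≤ R)
    (h : ∀ m : ℕ, n < m → ((m : ℝ) - n) ^ (1 / p.toReal) ≤ R * W m)
    {a : K → ℂ} (ha : ∑' k, ENNReal.ofReal (w k) * ‖a k‖ₑ ≤ 1) {ε : ℝ≥0∞} (hε : 0 < ε) :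
    ∃ A : Finset K, A.card ≤ n ∧
      eLpNorm ((↑A : Set K)ᶜ.indicator a) p Measure.count ≤ ENNReal.ofReal R + ε := by
  classical
  have hw0 : ∀ k, 0 ≤ w k := fun k => zero_le_one.trans (hw k)
  have hsum : ∑' k, ‖a k‖ₑ ≠ ∞ := by
    refine ne_top_of_le_ne_top ENNReal.one_ne_top (le_trans ?_ ha)
    refine ENNReal.tsum_le_tsum fun k => ?_
    exact le_mul_of_one_le_left zero_le (ENNReal.one_le_ofReal.2 (hw k))
  -- Truncate to a finite set whose `ℓ_1` tail, and hence `ℓ_p` tail, is below `ε`.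
  obtain ⟨F, hF⟩ := ((ENNReal.tendsto_tsum_compl_atTop_zero hsum).eventually_lt_const hε).exists
  obtain ⟨A, hAF, hA, hle⟩ := exists_finset_eLpNorm_le hw0 hW hp hp' hR h F (fun k => ‖a k‖)
    (fun k _ => norm_nonneg _)
  refine ⟨A, by omega, ?_⟩
  have hsplit : (↑A : Set K)ᶜ.indicator a =
      (↑F \ ↑A : Set K).indicator a + (↑F : Set K)ᶜ.indicator a := by
    ext k
    by_cases hkF : k ∈ F
    · by_cases hkA : k ∈ A <;> simp [hkF, hkA]
    · have hkA : k ∉ A := fun hk => hkF (hAF hk)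
      simp [hkF, hkA]
  rw [hsplit]
  refine (eLpNorm_add_le (by fun_prop) (by fun_prop) hp).trans (add_le_add ?_ ?_)
  · have : eLpNorm ((↑F \ ↑A : Set K).indicator a) p Measure.count =
        eLpNorm ((↑F \ ↑A : Set K).indicator fun k => ‖a k‖) p Measure.count := by
      refine eLpNorm_congr_norm_ae (Eventually.of_forall fun k => ?_)
      rw [norm_indicator_eq_indicator_norm, norm_indicator_eq_indicator_norm]
      simp
    rw [this]
    refine hle.trans (ENNReal.ofReal_le_ofReal ?_)
    refine mul_le_of_le_one_right hR ?_
    rw [← ENNReal.ofReal_le_one, ENNReal.ofReal_sum_of_nonneg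
      fun k _ => mul_nonneg (hw0 k) (norm_nonneg _)]
    refine le_trans (le_of_eq ?_) ((ENNReal.sum_le_tsum F).trans ha)
    refine Finset.sum_congr rfl fun k _ => ?_
    rw [ENNReal.ofReal_mul (hw0 k), ofReal_norm]
  · refine (eLpNorm_count_le_tsum _ hp hp').trans (le_trans (le_of_eq ?_) hF.le)
    refine Eq.trans ?_ (tsum_subtype {k | k ∉ F} fun k => ‖a k‖ₑ).symm
    refine tsum_congr fun k => ?_
    rw [enorm_indicator_eq_indicator_enorm]
    rfl

end SequenceSpace

/-! ### Reduction of the widths to minimal weight sums -/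

section Widths

variable {d : ℕ}

lemma fourierCoeffTorus_sub_sum (f : L1 d) {ι : Type*} (s : Finset ι) (c : ι → ℂ)
    (φ : ι → Fin d → ℤ) (l : Fin d → ℤ) :
    fourierCoeffTorus (f - ∑ j ∈ s, c j • charL1 (φ j)) l =
      fourierCoeffTorus f l - ∑ j ∈ s, if φ j = l then c j else 0 := by
  simp only [← coeffHom_apply, map_sub, map_sum, map_smul]
  simp only [coeffHom_apply, fourierCoeffTorus_charL1, smul_eq_mul, mul_ite, mul_one, mul_zero]

/-- The widths are defined with exactly `n` terms, repetitions allowed, so a smaller set of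
frequencies is padded with zero coefficients. -/
lemma exists_fin_sum_eq {K V : Type*} [Nonempty K] [AddCommGroup V] [Module ℂ V] (x : K → V)
    (c : K → ℂ) {n : ℕ} {A : Finset K} (hA : A.card ≤ n) :
    ∃ (b : Fin n → ℂ) (φ : Fin n → K), ∑ j, b j • x (φ j) = ∑ k ∈ A, c k • x k := by
  classical
  induction n generalizing A with
  | zero =>
    have : A = ∅ := Finset.card_eq_zero.1 (by omega)
    subst this
    exact ⟨Fin.elim0, Fin.elim0, by simp⟩
  | succ n ih =>
    rcases A.eq_empty_or_nonempty with rfl | ⟨k, hk⟩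
    · exact ⟨0, fun _ => Classical.arbitrary K, by simp⟩
    · obtain ⟨b, φ, h⟩ := ih (A := A.erase k) (by rw [Finset.card_erase_of_mem hk]; omega)
      refine ⟨Fin.cons (c k) b, Fin.cons k φ, ?_⟩
      rw [Fin.sum_univ_succ]
      simp only [Fin.cons_zero, Fin.cons_succ, h]
      exact Finset.add_sum_erase A (fun k => c k • x k) hk

lemma normF_one_eq (w : (Fin d → ℤ) → ℝ) (hw : ∀ k, 1 ≤ w k) (f : L1 d) :
    normF w 1 f = ∑' k, ENNReal.ofReal (w k) * ‖fourierCoeffTorus f k‖ₑ := by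
  simp only [normF, ENNReal.rpow_one, div_one, enorm_mul]
  refine tsum_congr fun k => ?_
  rw [← ofReal_norm (w k : ℂ), Complex.norm_real,
    Real.norm_of_nonneg (zero_le_one.trans (hw k))]

lemma summable_norm_of_tsum_ne_top {ι : Type*} {a : ι → ℂ} (h : ∑' k, ‖a k‖ₑ ≠ ∞) :
    Summable fun k => ‖a k‖ := by
  have := ENNReal.summable_toReal h
  simpa using this

variable {normY : L1 d → ℝ≥0∞} {p : ℝ≥0∞}

/-- Upper bound for the widths of weighted Wiener classes. -/
theorem nTermWidth_le (hp : 1 ≤ p) (hp' : p ≠ ∞)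
    (hY : ∀ f : L1 d, (Summable fun k => ‖fourierCoeffTorus f k‖) →
      normY f = eLpNorm (fourierCoeffTorus f) p Measure.count)
    {w : (Fin d → ℤ) → ℝ} (hw : ∀ k, 1 ≤ w k) {W : ℕ → ℝ}
    (hW : ∀ A : Finset (Fin d → ℤ), W A.card ≤ ∑ k ∈ A, w k)
    {n : ℕ} {R : ℝ} (hR : 0 ≤ R)
    (h : ∀ m : ℕ, n < m → ((m : ℝ) - n) ^ (1 / p.toReal) ≤ R * W m) :
    nTermWidth (normF w 1) normY (trigSystem d) n ≤ ENNReal.ofReal R := by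
  classical
  refine iSup₂_le fun f hf => ?_
  rw [normF_one_eq w hw] at hf
  have hsum : ∑' k, ‖fourierCoeffTorus f k‖ₑ ≠ ∞ := by
    refine ne_top_of_le_ne_top ENNReal.one_ne_top (le_trans ?_ hf)
    refine ENNReal.tsum_le_tsum fun k => ?_
    exact le_mul_of_one_le_left zero_le (ENNReal.one_le_ofReal.2 (hw k))
  refine _root_.le_of_forall_pos_le_add fun ε hε => ?_
  obtain ⟨A, hA, hle⟩ := exists_finset_eLpNorm_compl_le hw hW hp hp' hR h hf hε
  obtain ⟨b, φ, hφ⟩ := exists_fin_sum_eq (charL1 (d := d)) (fourierCoeffTorus f) hA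
  refine (iInf₂_le b (fun j => ⟨charL1 (φ j), φ j, rfl⟩)).trans ?_
  simp only
  rw [hφ]
  have hcoef : fourierCoeffTorus (f - ∑ k ∈ A, fourierCoeffTorus f k • charL1 k) =
      (↑A : Set (Fin d → ℤ))ᶜ.indicator (fourierCoeffTorus f) := by
    ext l
    refine (fourierCoeffTorus_sub_sum f A (fourierCoeffTorus f) id l).trans ?_
    by_cases hl : l ∈ A <;> simp [hl]
  rw [hY, hcoef]
  · exact hle
  · rw [hcoef]
    refine Summable.of_nonneg_of_le (fun _ => norm_nonneg _) (fun k => ?_)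
      (summable_norm_of_tsum_ne_top hsum)
    exact norm_indicator_le_norm_self _ _

/-- Lower bound for the widths of weighted Wiener classes. -/
theorem le_nTermWidth (hp : 1 ≤ p) (hp' : p ≠ ∞)
    (hY : ∀ f : L1 d, (Summable fun k => ‖fourierCoeffTorus f k‖) →
      normY f = eLpNorm (fourierCoeffTorus f) p Measure.count)
    {w : (Fin d → ℤ) → ℝ} (hw : ∀ k, 1 ≤ w k) {n : ℕ} {A : Finset (Fin d → ℤ)}
    (hA : n ≤ A.card) (hA0 : A.Nonempty) :
    ENNReal.ofReal (((A.card : ℝ) - n) ^ (1 / p.toReal) / ∑ k ∈ A, w k) ≤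
      nTermWidth (normF w 1) normY (trigSystem d) n := by
  classical
  have hw0 : ∀ k, 0 < w k := fun k => zero_lt_one.trans_le (hw k)
  set S := ∑ k ∈ A, w k with hS
  have hS0 : 0 < S := Finset.sum_pos (fun k _ => hw0 k) hA0
  -- The extremal function: all coefficients on `A` equal `S⁻¹`, so its weighted norm is exactly
  -- `1`. The shape `0 - ∑` lets `fourierCoeffTorus_sub_sum` compute them.
  let f : L1 d := 0 - ∑ k ∈ A, (-(S⁻¹ : ℝ) : ℂ) • charL1 k
  have hz : ∀ l : Fin d → ℤ, fourierCoeffTorus (0 : L1 d) l = 0 := fun l => by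
    rw [← coeffHom_apply, map_zero]
  have hf : fourierCoeffTorus f = (↑A : Set (Fin d → ℤ)).indicator fun _ => ((S⁻¹ : ℝ) : ℂ) := by
    ext l
    refine (fourierCoeffTorus_sub_sum 0 A _ id l).trans ?_
    rw [hz]
    by_cases hl : l ∈ A <;> simp [hl]
  refine le_iSup₂_of_le f ?_ ?_
  · rw [normF_one_eq w hw, hf]
    have : ∀ k, ENNReal.ofReal (w k) *
        ‖(↑A : Set (Fin d → ℤ)).indicator (fun _ => ((S⁻¹ : ℝ) : ℂ)) k‖ₑ =
        if k ∈ A then ENNReal.ofReal (w k * S⁻¹) else 0 := fun k => by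
      by_cases hk : k ∈ A
      · rw [Set.indicator_of_mem (by simpa using hk), if_pos hk, ← ofReal_norm, Complex.norm_real,
          Real.norm_of_nonneg (by positivity), ENNReal.ofReal_mul (hw0 k).le]
      · simp [hk]
    simp only [this]
    rw [tsum_eq_sum (s := A) (fun k hk => if_neg hk), Finset.sum_congr rfl fun k hk => if_pos hk,
      ← ENNReal.ofReal_sum_of_nonneg fun k _ => mul_nonneg (hw0 k).le (by positivity),
      ← Finset.sum_mul, ← hS, mul_inv_cancel₀ hS0.ne', ENNReal.ofReal_one]
  · refine le_iInf₂ fun b g => ?_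
    choose φ hφ using fun j => (g j).2
    simp only [← hφ]
    -- The approximant only touches frequencies in `B`, so at least `|A| - n` coefficients of size
    -- `S⁻¹` survive in the error.
    set B : Finset (Fin d → ℤ) := Finset.univ.image φ with hB
    have hBn : B.card ≤ n := Finset.card_image_le.trans (by simp)
    have hcoef := fourierCoeffTorus_sub_sum f Finset.univ b φ
    have hout : ∀ l, l ∉ B → fourierCoeffTorus (f - ∑ j, b j • charL1 (φ j)) l =
        fourierCoeffTorus f l := fun l hl => by
      rw [hcoef, Finset.sum_eq_zero, sub_zero]
      intro j _
      refine if_neg fun h => hl ?_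
      rw [hB, ← h]
      exact Finset.mem_image_of_mem _ (Finset.mem_univ j)
    rw [hY]
    · have hmono : eLpNorm ((↑(A \ B) : Set (Fin d → ℤ)).indicator fun _ => ((S⁻¹ : ℝ) : ℂ)) p
          Measure.count ≤
          eLpNorm (fourierCoeffTorus (f - ∑ j, b j • charL1 (φ j))) p Measure.count := by
        refine eLpNorm_mono fun l => ?_
        by_cases hl : l ∈ A \ B
        · rw [hout l (Finset.mem_sdiff.1 hl).2, hf, Set.indicator_of_mem (by simpa using hl),
            Set.indicator_of_mem (by simpa using (Finset.mem_sdiff.1 hl).1)]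
        · rw [Set.indicator_of_notMem (by simpa using hl), norm_zero]
          exact norm_nonneg _
      refine le_trans ?_ hmono
      rw [eLpNorm_indicator_const_count _ _ hp hp', ← ofReal_norm, Complex.norm_real,
        Real.norm_of_nonneg (by positivity), ← ENNReal.ofReal_natCast,
        ENNReal.ofReal_rpow_of_nonneg (by positivity) (by positivity),
        ← ENNReal.ofReal_mul (by positivity), mul_comm, div_eq_mul_inv]
      refine ENNReal.ofReal_le_ofReal ?_
      have h1 : A.card - n ≤ (A \ B).card := by
        have := Finset.le_card_sdiff B A
        omega
      have h2 : (A.card : ℝ) - n ≤ (A \ B).card := by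
        rw [← Nat.cast_sub hA]
        exact_mod_cast h1
      have h3 : (0 : ℝ) ≤ (A.card : ℝ) - n := by
        rw [← Nat.cast_sub hA]; positivity
      gcongr
    · refine summable_of_ne_finset_zero (s := A ∪ B) fun l hl => ?_
      rw [Finset.mem_union, not_or] at hl
      rw [hout l hl.2, hf, Set.indicator_of_notMem (by simpa using hl.1), norm_zero]

end Widths

/-! ### Asymptotic cardinality of hyperbolic crosses -/

section Counting

open Asymptotics Real

/-- A size function on `ℤ` which is asymptotically the absolute value. -/
structure IsSize (ρ : ℤ → ℝ) : Prop where
  one_le : ∀ k, 1 ≤ ρ k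
  abs_cast_le : ∀ k : ℤ, |(k : ℝ)| ≤ ρ k
  le_mul_add : ∀ ε : ℝ, 0 < ε → ∃ B : ℝ, ∀ k : ℤ, ρ k ≤ (1 + ε) * |(k : ℝ)| + B

/-- The product of the sizes of the coordinates. -/
noncomputable def prodSize (ρ : ℤ → ℝ) {d : ℕ} (k : Fin d → ℤ) : ℝ := ∏ i, ρ (k i)

open Classical in
/-- The integers of size at most `x`. -/
noncomputable def sizeBall (ρ : ℤ → ℝ) (x : ℝ) : Finset ℤ :=
  {k ∈ Finset.Icc (-⌊x⌋) ⌊x⌋ | ρ k ≤ x}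

open Classical in
/-- The hyperbolic cross of the `k ∈ ℤ^d` with product of sizes at most `x`. -/
noncomputable def hypCross (ρ : ℤ → ℝ) (d : ℕ) (x : ℝ) : Finset (Fin d → ℤ) :=
  {k ∈ Fintype.piFinset fun _ => Finset.Icc (-⌊x⌋) ⌊x⌋ | prodSize ρ k ≤ x}

variable {ρ : ℤ → ℝ}

lemma IsSize.pos (hρ : IsSize ρ) (k : ℤ) : 0 < ρ k := zero_lt_one.trans_le (hρ.one_le k)

lemma IsSize.one_le_prodSize (hρ : IsSize ρ) {d : ℕ} (k : Fin d → ℤ) : 1 ≤ prodSize ρ k :=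
  Finset.one_le_prod fun i _ => hρ.one_le (k i)

lemma IsSize.prodSize_pos (hρ : IsSize ρ) {d : ℕ} (k : Fin d → ℤ) : 0 < prodSize ρ k :=
  zero_lt_one.trans_le (hρ.one_le_prodSize k)

lemma mem_Icc_floor_of_abs_le {k : ℤ} {x : ℝ} (h : |(k : ℝ)| ≤ x) :
    k ∈ Finset.Icc (-⌊x⌋) ⌊x⌋ := by
  rw [Finset.mem_Icc, neg_le, Int.le_floor, Int.le_floor]
  push_cast
  exact ⟨(neg_le_abs _).trans h, (le_abs_self _).trans h⟩

lemma IsSize.mem_sizeBall (hρ : IsSize ρ) {x : ℝ} {k : ℤ} : k ∈ sizeBall ρ x ↔ ρ k ≤ x := by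
  simp only [sizeBall, Finset.mem_filter, and_iff_right_iff_imp]
  exact fun h => mem_Icc_floor_of_abs_le ((hρ.abs_cast_le k).trans h)

lemma IsSize.le_prodSize (hρ : IsSize ρ) {d : ℕ} (k : Fin d → ℤ) (i : Fin d) :
    ρ (k i) ≤ prodSize ρ k := by
  rw [prodSize, ← Finset.mul_prod_erase _ _ (Finset.mem_univ i)]
  exact le_mul_of_one_le_right (hρ.pos _).le (Finset.one_le_prod fun i _ => hρ.one_le (k i))

lemma IsSize.mem_hypCross (hρ : IsSize ρ) {d : ℕ} {x : ℝ} {k : Fin d → ℤ} :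
    k ∈ hypCross ρ d x ↔ prodSize ρ k ≤ x := by
  simp only [hypCross, Finset.mem_filter, and_iff_right_iff_imp, Fintype.mem_piFinset]
  exact fun h i => mem_Icc_floor_of_abs_le
    ((hρ.abs_cast_le _).trans ((hρ.le_prodSize k i).trans h))

lemma card_sizeBall_le {x : ℝ} (hx : 0 ≤ x) :
    ((sizeBall ρ x).card : ℝ) ≤ 2 * x + 1 := by
  classical
  have h1 : (sizeBall ρ x).card ≤ (Finset.Icc (-⌊x⌋) ⌊x⌋).card := Finset.card_filter_le _ _
  have h2 : ((Finset.Icc (-⌊x⌋) ⌊x⌋).card : ℝ) = 2 * (⌊x⌋ : ℝ) + 1 := by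
    have h3 : ((Finset.Icc (-⌊x⌋) ⌊x⌋).card : ℤ) = 2 * ⌊x⌋ + 1 := by
      have := Int.floor_nonneg.2 hx
      rw [Int.card_Icc, Int.toNat_of_nonneg] <;> linarith
    exact_mod_cast h3
  have h4 := Int.floor_le x
  have h5 : ((sizeBall ρ x).card : ℝ) ≤ ((Finset.Icc (-⌊x⌋) ⌊x⌋).card : ℝ) := by exact_mod_cast h1
  linarith

lemma IsSize.le_card_sizeBall (hρ : IsSize ρ) {ε : ℝ} (hε : 0 < ε) :
    ∃ B : ℝ, 0 ≤ B ∧ ∀ x : ℝ, 0 ≤ x → 2 * (1 - ε) * x - B ≤ (sizeBall ρ x).card := by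
  obtain ⟨B, hB⟩ := hρ.le_mul_add ε hε
  refine ⟨2 * |B| + 1, by positivity, fun x hx => ?_⟩
  -- The radius for which `|k| ≤ y` forces `ρ k ≤ (1 + ε) y + |B| = x`.
  set y := (x - |B|) / (1 + ε) with hy
  rcases lt_or_ge y 0 with h0 | h0
  · have h1 : x - |B| < 0 := by
      rw [hy, div_lt_iff₀ (by linarith)] at h0
      linarith
    have : (0 : ℝ) ≤ (sizeBall ρ x).card := by positivity
    nlinarith
  · have hsub : Finset.Icc (-⌊y⌋) ⌊y⌋ ⊆ sizeBall ρ x := by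
      intro k hk
      rw [hρ.mem_sizeBall]
      rw [Finset.mem_Icc, neg_le, Int.le_floor, Int.le_floor] at hk
      push_cast at hk
      have h1 : |(k : ℝ)| ≤ y := abs_le'.2 ⟨hk.2, hk.1⟩
      calc ρ k ≤ (1 + ε) * |(k : ℝ)| + B := hB k
        _ ≤ (1 + ε) * y + |B| := by
          gcongr
          exact le_abs_self B
        _ = x := by rw [hy]; field_simp; ring
    have h3 : ((Finset.Icc (-⌊y⌋) ⌊y⌋).card : ℤ) = 2 * ⌊y⌋ + 1 := by
      have := Int.floor_nonneg.2 h0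
      rw [Int.card_Icc, Int.toNat_of_nonneg] <;> linarith
    have h4 : ((Finset.Icc (-⌊y⌋) ⌊y⌋).card : ℝ) = 2 * (⌊y⌋ : ℝ) + 1 := by exact_mod_cast h3
    have h5 : ((Finset.Icc (-⌊y⌋) ⌊y⌋).card : ℝ) ≤ (sizeBall ρ x).card := by
      exact_mod_cast Finset.card_le_card hsub
    have h6 := Int.lt_floor_add_one y
    have h7 : (1 - ε) * (x - |B|) ≤ y := by
      have h9 : 0 ≤ x - |B| := by
        rw [hy, le_div_iff₀ (by linarith)] at h0
        linarith
      rw [hy, le_div_iff₀ (by linarith)]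
      nlinarith [mul_nonneg (sq_nonneg ε) h9]
    have h8 : 0 ≤ ε * |B| := by positivity
    nlinarith

/-- Fibre over the last `d` coordinates: once they are fixed, the first one ranges over a
one-dimensional ball. -/
lemma IsSize.card_hypCross_succ (hρ : IsSize ρ) (d : ℕ) (x : ℝ) :
    (hypCross ρ (d + 1) x).card =
      ∑ k ∈ hypCross ρ d x, (sizeBall ρ (x / prodSize ρ k)).card := by
  classical
  rw [← Finset.card_sigma]
  refine Finset.card_bij' (fun k _ => ⟨Fin.tail k, k 0⟩) (fun q _ => Fin.cons q.2 q.1) ?_ ?_ ?_ ?_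
  · intro k hk
    rw [hρ.mem_hypCross, prodSize, Fin.prod_univ_succ] at hk
    rw [Finset.mem_sigma, hρ.mem_hypCross, hρ.mem_sizeBall, le_div_iff₀ (hρ.prodSize_pos _)]
    refine ⟨?_, hk⟩
    exact le_trans (le_mul_of_one_le_left (hρ.prodSize_pos _).le (hρ.one_le (k 0))) hk
  · rintro ⟨k, j⟩ hk
    rw [Finset.mem_sigma, hρ.mem_sizeBall, le_div_iff₀ (hρ.prodSize_pos _)] at hk
    rw [hρ.mem_hypCross, prodSize, Fin.prod_univ_succ]
    exact hk.2
  · intro k _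
    exact Fin.cons_self_tail k
  · rintro ⟨k, j⟩ _
    simp

/-- The sum of the reciprocals of the product sizes over the hyperbolic cross. -/
noncomputable def recipSum (ρ : ℤ → ℝ) (d : ℕ) (x : ℝ) : ℝ :=
  ∑ k ∈ hypCross ρ d x, (prodSize ρ k)⁻¹

lemma IsSize.card_hypCross_succ_le (hρ : IsSize ρ) (d : ℕ) {x : ℝ} (hx : 0 ≤ x) :
    ((hypCross ρ (d + 1) x).card : ℝ) ≤ 2 * (x * recipSum ρ d x) + (hypCross ρ d x).card := by
  rw [hρ.card_hypCross_succ, recipSum, Finset.mul_sum, Finset.mul_sum, Finset.card_eq_sum_ones]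
  push_cast
  rw [← Finset.sum_add_distrib]
  refine Finset.sum_le_sum fun k _ => ?_
  rw [← div_eq_mul_inv]
  exact card_sizeBall_le (div_nonneg hx (hρ.prodSize_pos k).le)

lemma IsSize.le_card_hypCross_succ (hρ : IsSize ρ) (d : ℕ) {ε : ℝ} (hε : 0 < ε) :
    ∃ B : ℝ, 0 ≤ B ∧ ∀ x : ℝ, 0 ≤ x →
      2 * (1 - ε) * (x * recipSum ρ d x) - B * (hypCross ρ d x).card ≤
        ((hypCross ρ (d + 1) x).card : ℝ) := by
  obtain ⟨B, hB0, hB⟩ := hρ.le_card_sizeBall hε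
  refine ⟨B, hB0, fun x hx => ?_⟩
  rw [hρ.card_hypCross_succ, recipSum, Finset.mul_sum, Finset.mul_sum, Finset.card_eq_sum_ones]
  push_cast
  rw [Finset.mul_sum, ← Finset.sum_sub_distrib]
  refine Finset.sum_le_sum fun k _ => ?_
  rw [← div_eq_mul_inv, mul_one]
  exact hB _ (div_nonneg hx (hρ.prodSize_pos k).le)

lemma IsSize.recipSum_nonneg (hρ : IsSize ρ) (d : ℕ) (x : ℝ) : 0 ≤ recipSum ρ d x :=
  Finset.sum_nonneg fun k _ => (inv_pos.2 (hρ.prodSize_pos k)).le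

/-- A fibre has about `2 x / prodSize ρ k` points, which sums to `2 x * recipSum ρ d x`. The bounded
error per fibre totals `O` of the number of fibres, negligible by `hN`. -/
lemma IsSize.isEquivalent_card_succ (hρ : IsSize ρ) {d : ℕ} {c : ℝ} (hc : c ≠ 0)
    (hS : recipSum ρ d ~[atTop] fun x => c * log x ^ d)
    (hN : (fun x => ((hypCross ρ d x).card : ℝ)) =o[atTop] fun x => x * log x ^ d) :
    (fun x => ((hypCross ρ (d + 1) x).card : ℝ)) ~[atTop] fun x => 2 * c * (x * log x ^ d) := by
  have hxS : (fun x => x * recipSum ρ d x) =O[atTop] fun x => x * log x ^ d :=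
    (isBigO_refl _ _).mul (hS.isBigO.trans (isBigO_const_mul_self c _ _))
  have h1 : (fun x => ((hypCross ρ (d + 1) x).card : ℝ) - 2 * (x * recipSum ρ d x)) =o[atTop]
      fun x => x * log x ^ d := by
    obtain ⟨C, hC0, hC⟩ := hxS.exists_pos
    rw [isLittleO_iff]
    intro η hη
    -- The relative error `2ε` of the main term and the error `B` per fibre each receive the budget
    -- `η / 2`.
    obtain ⟨B, hB0, hB⟩ := hρ.le_card_hypCross_succ d (ε := η / (4 * C)) (by positivity)
    have h2 := isLittleO_iff.1 hN (c := η / (2 * (B + 1))) (by positivity)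
    filter_upwards [h2, hC.bound, eventually_ge_atTop 0] with x h2 h3 hx
    have h4 := hB x hx
    have h5 := hρ.card_hypCross_succ_le d hx
    set g := ‖x * log x ^ d‖
    have hg : 0 ≤ g := norm_nonneg _
    rw [Real.norm_of_nonneg (mul_nonneg hx (hρ.recipSum_nonneg d x))] at h3
    rw [Real.norm_of_nonneg (by positivity)] at h2
    set N := ((hypCross ρ d x).card : ℝ)
    have h6 : (B + 1) * N ≤ η / 2 * g := by
      calc (B + 1) * N ≤ (B + 1) * (η / (2 * (B + 1)) * g) := by gcongr
        _ = η / 2 * g := by field_simp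
    have h7 : 2 * (η / (4 * C)) * (x * recipSum ρ d x) ≤ η / 2 * g := by
      calc 2 * (η / (4 * C)) * (x * recipSum ρ d x) ≤ 2 * (η / (4 * C)) * (C * g) := by gcongr
        _ = η / 2 * g := by field_simp; norm_num
    have hN0 : 0 ≤ N := by positivity
    have hBN : 0 ≤ B * N := by positivity
    have hgη : 0 ≤ η * g := by positivity
    rw [Real.norm_eq_abs, abs_le]
    constructor <;> nlinarith
  have h2 : (fun x => 2 * (x * recipSum ρ d x) - 2 * c * (x * log x ^ d)) =o[atTop]
      fun x => x * log x ^ d := by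
    have h3 : (recipSum ρ d - fun x => c * log x ^ d) =o[atTop] fun x => log x ^ d :=
      hS.isLittleO.trans_isBigO (isBigO_const_mul_self c _ _)
    have h4 := ((isBigO_refl (fun x : ℝ => x) atTop).mul_isLittleO h3).const_mul_left 2
    refine h4.congr_left fun x => ?_
    simp only [Pi.sub_apply]
    ring
  have h3 := (h1.add h2).trans_isBigO
    (isBigO_self_const_mul (mul_ne_zero two_ne_zero hc) (fun x => x * log x ^ d) atTop)
  refine h3.congr_left fun x => ?_
  simp only [Pi.sub_apply]
  ring

/-- Integration preserves `o` for nonnegative functions with divergent integral. -/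
lemma isLittleO_intervalIntegral {e h : ℝ → ℝ} (he : ∀ x, 1 ≤ x → IntervalIntegrable e volume 1 x)
    (hh : ∀ x, 1 ≤ x → IntervalIntegrable h volume 1 x) (h0 : ∀ x, 1 ≤ x → 0 ≤ h x)
    (heh : e =o[atTop] h) (htop : Tendsto (fun x => ∫ y in (1 : ℝ)..x, h y) atTop atTop) :
    (fun x => ∫ y in (1 : ℝ)..x, e y) =o[atTop] fun x => ∫ y in (1 : ℝ)..x, h y := by
  rw [isLittleO_iff]
  intro ε hε
  -- Beyond `X` the integrand is at most `ε / 2` times `h`; the fixed contribution up to `X` is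
  -- absorbed by the divergence of `∫ h`.
  obtain ⟨X, hX1, hX⟩ : ∃ X : ℝ, 1 ≤ X ∧ ∀ y, X ≤ y → ‖e y‖ ≤ ε / 2 * h y := by
    obtain ⟨X, hX⟩ := eventually_atTop.1
      ((isLittleO_iff.1 heh (half_pos hε)).and (eventually_ge_atTop 1))
    refine ⟨max X 1, le_max_right _ _, fun y hy => ?_⟩
    have := hX y ((le_max_left _ _).trans hy)
    rw [Real.norm_of_nonneg (h0 y this.2)] at this
    exact this.1
  filter_upwards [eventually_ge_atTop X,
    htop.eventually_ge_atTop (2 / ε * ‖∫ y in (1 : ℝ)..X, e y‖)] with x hx hbig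
  have hx1 := hX1.trans hx
  have heX : IntervalIntegrable e volume X x := (he X hX1).symm.trans (he x hx1)
  have hhX : IntervalIntegrable h volume X x := (hh X hX1).symm.trans (hh x hx1)
  have hH : 0 ≤ ∫ y in (1 : ℝ)..x, h y :=
    intervalIntegral.integral_nonneg hx1 fun y hy => h0 y hy.1
  rw [Real.norm_of_nonneg hH, ← intervalIntegral.integral_add_adjacent_intervals (he X hX1) heX]
  have h1 : ‖∫ y in X..x, e y‖ ≤ ∫ y in X..x, ε / 2 * h y :=
    intervalIntegral.norm_integral_le_of_norm_le hx
      (Eventually.of_forall fun y hy => hX y hy.1.le) (hhX.const_mul _)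
  rw [intervalIntegral.integral_const_mul] at h1
  have h2 : ∫ y in X..x, h y ≤ ∫ y in (1 : ℝ)..x, h y := by
    rw [← intervalIntegral.integral_add_adjacent_intervals (hh X hX1) hhX]
    have := intervalIntegral.integral_nonneg (μ := volume) hX1 fun y hy => h0 y hy.1
    linarith
  have h3 : ‖∫ y in (1 : ℝ)..X, e y‖ ≤ ε / 2 * ∫ y in (1 : ℝ)..x, h y := by
    calc ‖∫ y in (1 : ℝ)..X, e y‖ = ε / 2 * (2 / ε * ‖∫ y in (1 : ℝ)..X, e y‖) := by field_simp
      _ ≤ _ := by gcongr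
  calc _ ≤ _ := norm_add_le _ _
    _ ≤ ε / 2 * (∫ y in (1 : ℝ)..x, h y) + ε / 2 * ∫ y in (1 : ℝ)..x, h y := by
      refine add_le_add h3 (h1.trans ?_)
      gcongr
    _ = _ := by ring

lemma intervalIntegrable_inv_sq {a b : ℝ} (ha : 0 < a) (hab : a ≤ b) :
    IntervalIntegrable (fun y : ℝ => (y ^ 2)⁻¹) volume a b := by
  refine ContinuousOn.intervalIntegrable fun y hy => ?_
  rw [Set.uIcc_of_le hab] at hy
  have : y ≠ 0 := (ha.trans_le hy.1).ne'
  exact ContinuousAt.continuousWithinAt (by fun_prop (disch := positivity))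

lemma integral_inv_sq {a b : ℝ} (ha : 0 < a) (hab : a ≤ b) :
    ∫ y in a..b, (y ^ 2)⁻¹ = a⁻¹ - b⁻¹ := by
  have : ∀ y ∈ Set.uIcc a b, HasDerivAt (fun y : ℝ => -y⁻¹) ((y ^ 2)⁻¹) y := fun y hy => by
    rw [Set.uIcc_of_le hab] at hy
    have : y ≠ 0 := (ha.trans_le hy.1).ne'
    exact (hasDerivAt_inv this).neg.congr_deriv (neg_neg _)
  rw [intervalIntegral.integral_eq_sub_of_hasDerivAt this (intervalIntegrable_inv_sq ha hab)]
  ring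

lemma intervalIntegrable_ite_inv_sq (P : ℝ) {x : ℝ} (hx : 1 ≤ x) :
    IntervalIntegrable (fun y : ℝ => if P ≤ y then (y ^ 2)⁻¹ else 0) volume 1 x := by
  have h := intervalIntegrable_inv_sq zero_lt_one hx
  rw [intervalIntegrable_iff] at h ⊢
  exact h.indicator (measurableSet_Ici (a := P))

lemma integral_ite_inv_sq {P x : ℝ} (hP : 1 ≤ P) (hx : P ≤ x) :
    ∫ y in (1 : ℝ)..x, (if P ≤ y then (y ^ 2)⁻¹ else 0) = P⁻¹ - x⁻¹ := by
  have hi := fun x hx => intervalIntegrable_ite_inv_sq P (x := x) hx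
  rw [← intervalIntegral.integral_add_adjacent_intervals (hi P hP)
    ((hi P hP).symm.trans (hi x (hP.trans hx)))]
  have h1 : ∫ y in (1 : ℝ)..P, (if P ≤ y then (y ^ 2)⁻¹ else 0) = 0 := by
    refine intervalIntegral.integral_zero_ae ?_
    have : ∀ᵐ y : ℝ, y ≠ P := by simp [ae_iff]
    filter_upwards [this] with y hy hy'
    rw [Set.uIoc_of_le hP] at hy'
    exact if_neg (not_le.2 (lt_of_le_of_ne hy'.2 hy))
  have h2 : ∫ y in P..x, (if P ≤ y then (y ^ 2)⁻¹ else 0) = ∫ y in P..x, (y ^ 2)⁻¹ := by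
    refine intervalIntegral.integral_congr fun y hy => ?_
    rw [Set.uIcc_of_le hx] at hy
    exact if_pos hy.1
  rw [h1, h2, integral_inv_sq (by linarith) hx, zero_add]

/-- Rewrites a count over a cross varying with `y` as a sum over one fixed cross, so that sum and
integral can be exchanged. -/
lemma IsSize.card_mul_inv_sq_eq (hρ : IsSize ρ) (d : ℕ) {x y : ℝ} (hy : y ≤ x) :
    ((hypCross ρ d y).card : ℝ) * (y ^ 2)⁻¹ =
      ∑ k ∈ hypCross ρ d x, if prodSize ρ k ≤ y then (y ^ 2)⁻¹ else 0 := by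
  classical
  rw [← Finset.sum_filter, Finset.sum_const, nsmul_eq_mul]
  congr 3
  ext k
  rw [Finset.mem_filter, hρ.mem_hypCross, hρ.mem_hypCross]
  exact ⟨fun h => ⟨h.trans hy, h⟩, fun h => h.2⟩

lemma IsSize.intervalIntegrable_card (hρ : IsSize ρ) (d : ℕ) {x : ℝ} (hx : 1 ≤ x) :
    IntervalIntegrable (fun y => ((hypCross ρ d y).card : ℝ) * (y ^ 2)⁻¹) volume 1 x := by
  have : IntervalIntegrable (fun y => ∑ k ∈ hypCross ρ d x,
      if prodSize ρ k ≤ y then (y ^ 2)⁻¹ else 0) volume 1 x := by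
    have := IntervalIntegrable.sum (μ := volume) (a := 1) (b := x) (hypCross ρ d x)
      (f := fun k y => if prodSize ρ k ≤ y then (y ^ 2)⁻¹ else 0)
      fun k _ => intervalIntegrable_ite_inv_sq (prodSize ρ k) hx
    convert! this using 1
    ext y
    simp
  refine this.congr fun y hy => ?_
  rw [Set.uIoc_of_le hx] at hy
  exact (hρ.card_mul_inv_sq_eq d hy.2).symm

/-- Summation by parts for the sum of reciprocals. -/
lemma IsSize.recipSum_eq (hρ : IsSize ρ) (d : ℕ) {x : ℝ} (hx : 1 ≤ x) :
    recipSum ρ d x = (hypCross ρ d x).card * x⁻¹ +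
      ∫ y in (1 : ℝ)..x, ((hypCross ρ d y).card : ℝ) * (y ^ 2)⁻¹ := by
  have h1 : ∫ y in (1 : ℝ)..x, ((hypCross ρ d y).card : ℝ) * (y ^ 2)⁻¹ =
      ∫ y in (1 : ℝ)..x, ∑ k ∈ hypCross ρ d x, if prodSize ρ k ≤ y then (y ^ 2)⁻¹ else 0 := by
    refine intervalIntegral.integral_congr fun y hy => ?_
    rw [Set.uIcc_of_le hx] at hy
    exact hρ.card_mul_inv_sq_eq d hy.2
  rw [h1, intervalIntegral.integral_finsetSum fun k _ =>
    intervalIntegrable_ite_inv_sq (prodSize ρ k) hx, recipSum, ← nsmul_eq_mul,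
    ← Finset.sum_const, ← Finset.sum_add_distrib]
  refine Finset.sum_congr rfl fun k hk => ?_
  rw [integral_ite_inv_sq (hρ.one_le_prodSize k) (hρ.mem_hypCross.1 hk)]
  ring

lemma integral_log_pow_div (d : ℕ) {x : ℝ} (hx : 1 ≤ x) :
    IntervalIntegrable (fun y => log y ^ d / y) volume 1 x ∧
      ∫ y in (1 : ℝ)..x, log y ^ d / y = log x ^ (d + 1) / (d + 1) := by
  have hi : IntervalIntegrable (fun y => log y ^ d / y) volume 1 x := by
    refine ContinuousOn.intervalIntegrable fun y hy => ?_
    rw [Set.uIcc_of_le hx] at hy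
    have : y ≠ 0 := (zero_lt_one.trans_le hy.1).ne'
    exact ContinuousAt.continuousWithinAt (by fun_prop (disch := positivity))
  refine ⟨hi, ?_⟩
  have : ∀ y ∈ Set.uIcc 1 x, HasDerivAt (fun y => log y ^ (d + 1) / ((d : ℝ) + 1))
      (log y ^ d / y) y := fun y hy => by
    rw [Set.uIcc_of_le hx] at hy
    have : y ≠ 0 := (zero_lt_one.trans_le hy.1).ne'
    refine (((hasDerivAt_log this).pow (d + 1)).div_const ((d : ℝ) + 1)).congr_deriv ?_
    have : (d : ℝ) + 1 ≠ 0 := by positivity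
    push_cast
    field_simp
  rw [intervalIntegral.integral_eq_sub_of_hasDerivAt this hi]
  simp

lemma isLittleO_log_pow_succ (d : ℕ) :
    (fun x => log x ^ d) =o[atTop] fun x => log x ^ (d + 1) := by
  exact (isLittleO_pow_pow_atTop_of_lt (𝕜 := ℝ) (Nat.lt_succ_self d)).comp_tendsto tendsto_log_atTop

/-- In the summation by parts, the boundary term is `O((log x)^d)`, of lower order, and the integral
is asymptotic to that of `c (log y)^d / y`. -/
lemma IsSize.isEquivalent_recipSum (hρ : IsSize ρ) {d d' : ℕ} {c : ℝ} (hc : c ≠ 0)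
    (hN : (fun x => ((hypCross ρ d' x).card : ℝ)) ~[atTop] fun x => c * (x * log x ^ d)) :
    recipSum ρ d' ~[atTop] fun x => c / (d + 1) * log x ^ (d + 1) := by
  have hd : (d : ℝ) + 1 ≠ 0 := by positivity
  have htop : Tendsto (fun x => log x ^ (d + 1)) atTop atTop :=
    (tendsto_pow_atTop (Nat.succ_ne_zero d)).comp tendsto_log_atTop
  have h1 : (fun x => ((hypCross ρ d' x).card : ℝ) * x⁻¹) =o[atTop]
      fun x => log x ^ (d + 1) := by
    have h2 := (hN.isBigO.trans (isBigO_const_mul_self c _ _)).mul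
      (isBigO_refl (fun x : ℝ => x⁻¹) atTop)
    refine (h2.trans_eventuallyEq ?_).trans_isLittleO (isLittleO_log_pow_succ d)
    filter_upwards [eventually_gt_atTop 0] with x hx
    field_simp
  have he : (fun y => ((hypCross ρ d' y).card : ℝ) * (y ^ 2)⁻¹ - c * (log y ^ d / y)) =o[atTop]
      fun y => log y ^ d / y := by
    have h2 := (hN.isLittleO.trans_isBigO (isBigO_const_mul_self c _ _)).mul_isBigO
      (isBigO_refl (fun x : ℝ => (x ^ 2)⁻¹) atTop)
    refine h2.congr' ?_ ?_
    · filter_upwards [eventually_gt_atTop 0] with x hx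
      simp only [Pi.sub_apply]
      field_simp
    · filter_upwards [eventually_gt_atTop 0] with x hx
      field_simp
  have hH : ∀ᶠ x : ℝ in atTop, ∫ y in (1 : ℝ)..x, log y ^ d / y = log x ^ (d + 1) / (d + 1) := by
    filter_upwards [eventually_ge_atTop 1] with x hx using (integral_log_pow_div d hx).2
  have h2 := isLittleO_intervalIntegral
    (fun x hx => (hρ.intervalIntegrable_card d' hx).sub
      ((integral_log_pow_div d hx).1.const_mul c))
    (fun x hx => (integral_log_pow_div d hx).1)
    (fun x hx => div_nonneg (pow_nonneg (log_nonneg hx) d) (by linarith)) he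
    ((htop.atTop_div_const (by positivity)).congr' (hH.mono fun x hx => hx.symm))
  have h3 : (fun x => ∫ y in (1 : ℝ)..x,
      (((hypCross ρ d' y).card : ℝ) * (y ^ 2)⁻¹ - c * (log y ^ d / y))) =o[atTop]
      fun x => log x ^ (d + 1) := by
    refine (h2.trans_eventuallyEq hH).trans_isBigO ?_
    simp only [div_eq_inv_mul]
    exact isBigO_const_mul_self _ _ _
  have h4 := (h1.add h3).trans_isBigO
    (isBigO_self_const_mul (div_ne_zero hc hd) (fun x => log x ^ (d + 1)) atTop)
  refine h4.congr' ?_ EventuallyEq.rfl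
  filter_upwards [eventually_ge_atTop 1] with x hx
  rw [Pi.sub_apply, hρ.recipSum_eq d' hx, intervalIntegral.integral_sub
    (hρ.intervalIntegrable_card d' hx) ((integral_log_pow_div d hx).1.const_mul c),
    intervalIntegral.integral_const_mul, (integral_log_pow_div d hx).2]
  ring

lemma IsSize.hypCross_zero (hρ : IsSize ρ) {x : ℝ} (hx : 1 ≤ x) :
    hypCross ρ 0 x = {Fin.elim0} := by
  ext k
  rw [hρ.mem_hypCross, Finset.mem_singleton]
  simp [prodSize, hx, Subsingleton.elim k Fin.elim0]

/-- The two claims feed each other through the induction on `d`. The cardinality is only claimed to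
be `o(x (log x)^d)`: that is all the next step needs, and it also covers `d = 0`. -/
lemma IsSize.recipSum_and_card (hρ : IsSize ρ) (d : ℕ) :
    (recipSum ρ d ~[atTop] fun x => 2 ^ d / (d.factorial : ℝ) * log x ^ d) ∧
      (fun x => ((hypCross ρ d x).card : ℝ)) =o[atTop] fun x => x * log x ^ d := by
  induction d with
  | zero =>
    constructor
    · refine EventuallyEq.isEquivalent ?_
      filter_upwards [eventually_ge_atTop 1] with x hx
      rw [recipSum, hρ.hypCross_zero hx]
      simp [prodSize]
    · have : (fun _ : ℝ => (1 : ℝ)) =o[atTop] fun x => x :=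
        isLittleO_const_left.2 (Or.inr tendsto_norm_atTop_atTop)
      refine this.congr' ?_ ?_
      · filter_upwards [eventually_ge_atTop 1] with x hx
        rw [hρ.hypCross_zero hx]
        simp
      · simp
  | succ d ih =>
    have hc : (2 ^ d / (d.factorial : ℝ)) ≠ 0 := by positivity
    have h1 := hρ.isEquivalent_card_succ hc ih.1 ih.2
    constructor
    · have h2 := hρ.isEquivalent_recipSum (mul_ne_zero two_ne_zero hc) h1
      convert! h2 using 2 with x
      rw [Nat.factorial_succ]
      push_cast
      field_simp
      ring
    · exact (h1.isBigO.trans (isBigO_const_mul_self _ _ _)).trans_isLittleO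
        ((isBigO_refl (fun x : ℝ => x) atTop).mul_isLittleO (isLittleO_log_pow_succ d))

/-- The cardinality of hyperbolic crosses. -/
theorem IsSize.isEquivalent_card_hypCross (hρ : IsSize ρ) (d : ℕ) :
    (fun x => ((hypCross ρ (d + 1) x).card : ℝ)) ~[atTop]
      fun x => 2 ^ (d + 1) / (d.factorial : ℝ) * (x * log x ^ d) := by
  have hc : (2 ^ d / (d.factorial : ℝ)) ≠ 0 := by positivity
  have h := hρ.isEquivalent_card_succ hc (hρ.recipSum_and_card d).1 (hρ.recipSum_and_card d).2
  convert! h using 2 with x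
  ring

end Counting

/-! ### Calculus of asymptotic equivalents: inversion and summation -/

section Equivalents

open Asymptotics Real

lemma isEquivalent_rpow_const {α : Type*} {l : Filter α} {u v : α → ℝ} (h : u ~[l] v)
    (hv : ∀ᶠ x in l, 0 < v x) (r : ℝ) : (fun x => u x ^ r) ~[l] fun x => v x ^ r := by
  have h1 := (isEquivalent_iff_tendsto_one (hv.mono fun x hx => hx.ne')).1 h
  refine isEquivalent_of_tendsto_one ?_
  have h2 := h1.rpow_const (p := r) (Or.inl one_ne_zero)
  rw [one_rpow] at h2
  refine h2.congr' ?_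
  filter_upwards [hv, h1.eventually_const_lt zero_lt_one] with x hx hx2
  have hu : 0 < u x := by
    rw [Pi.div_apply] at hx2
    exact (div_pos_iff_of_pos_right hx).1 hx2
  rw [Pi.div_apply, Pi.div_apply, div_rpow hu.le hx.le]

lemma isEquivalent_of_le_of_le {α : Type*} {l : Filter α} {a b c g : α → ℝ}
    (ha : a ~[l] g) (hc : c ~[l] g) (hg : ∀ᶠ x in l, 0 < g x) (hab : ∀ᶠ x in l, a x ≤ b x)
    (hbc : ∀ᶠ x in l, b x ≤ c x) : b ~[l] g := by
  have h0 := hg.mono fun x hx => hx.ne'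
  refine isEquivalent_of_tendsto_one (tendsto_of_tendsto_of_tendsto_of_le_of_le'
    ((isEquivalent_iff_tendsto_one h0).1 ha) ((isEquivalent_iff_tendsto_one h0).1 hc) ?_ ?_)
  · filter_upwards [hg, hab] with x hx h
    simp only [Pi.div_apply]
    gcongr
  · filter_upwards [hg, hbc] with x hx h
    simp only [Pi.div_apply]
    gcongr

lemma isEquivalent_sub_one : (fun x : ℝ => x - 1) ~[atTop] fun x => x := by
  have : (fun _ : ℝ => (-1 : ℝ)) =o[atTop] fun x => x :=
    isLittleO_const_left.2 (Or.inr tendsto_norm_atTop_atTop)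
  refine this.congr_left fun x => ?_
  simp

lemma isEquivalent_mul_log_pow_sub_one (D : ℕ) :
    (fun x => (x - 1) * log (x - 1) ^ D) ~[atTop] fun x => x * log x ^ D :=
  isEquivalent_sub_one.mul ((isEquivalent_sub_one.log tendsto_id).pow D)

lemma isEquivalent_log_mul_log_pow {c : ℝ} (hc : 0 < c) (D : ℕ) :
    (fun x => log (c * (x * log x ^ D))) ~[atTop] log := by
  have h1 : (fun _ : ℝ => log c) =o[atTop] log :=
    isLittleO_const_left.2 (Or.inr (tendsto_norm_atTop_atTop.comp tendsto_log_atTop))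
  have h2 : (fun x => D * log (log x)) =o[atTop] log :=
    (isLittleO_log_id_atTop.comp_tendsto tendsto_log_atTop).const_mul_left _
  refine (h1.add h2).congr' ?_ EventuallyEq.rfl
  filter_upwards [eventually_gt_atTop 1] with x hx
  have hl : 0 < log x := log_pos hx
  rw [Pi.sub_apply, log_mul hc.ne' (by positivity), log_mul (by positivity) (by positivity),
    log_pow]
  ring

/-- Inversion of `i ~ c x (log x)^D`. -/
lemma isEquivalent_of_natCast_isEquivalent {c : ℝ} (hc : 0 < c) (D : ℕ) {x : ℕ → ℝ}
    (hx : Tendsto x atTop atTop)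
    (h : (fun i : ℕ => (i : ℝ)) ~[atTop] fun i => c * (x i * log (x i) ^ D)) :
    x ~[atTop] fun i : ℕ => (i : ℝ) / (c * log i ^ D) := by
  have hcast := tendsto_natCast_atTop_atTop (R := ℝ)
  -- Taking logarithms gives `log i ~ log (x i)`, so the unknown logarithm can be replaced before
  -- dividing.
  have hlog : (fun i : ℕ => log (i : ℝ)) ~[atTop] fun i => log (x i) :=
    (h.log (h.tendsto_atTop hcast)).trans ((isEquivalent_log_mul_log_pow hc D).comp_tendsto hx)
  have h1 := h.symm.div ((IsEquivalent.refl (u := fun _ : ℕ => c)).mul (hlog.symm.pow D))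
  refine IsEquivalent.congr_left h1 ?_
  filter_upwards [hx.eventually_gt_atTop 1] with i hi
  have hl : 0 < log (x i) := log_pos hi
  simp only [Pi.div_apply, Pi.mul_apply, Pi.pow_apply]
  field_simp

lemma hasDerivAt_rpow_mul_log_rpow (s α : ℝ) {x : ℝ} (hx : 1 < x) :
    HasDerivAt (fun x => x ^ (s + 1) * log x ^ (-α))
      (x ^ s * log x ^ (-α) * (s + 1 - α / log x)) x := by
  have hl : 0 < log x := log_pos hx
  have h0 : 0 < x := by linarith
  have h1 := hasDerivAt_rpow_const (x := x) (p := s + 1) (Or.inl h0.ne')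
  have h2 := (hasDerivAt_log h0.ne').rpow_const (p := -α) (Or.inl hl.ne')
  refine (h1.mul h2).congr_deriv ?_
  rw [add_sub_cancel_right, rpow_add_one h0.ne', rpow_sub_one hl.ne']
  field_simp
  ring

/-- Mean value theorem on `[n, n + 1]`: the intermediate point is `~ n`, and the logarithm
contributes only the vanishing correction `α / log ξ`. -/
lemma isEquivalent_diff_rpow_mul_log_rpow {s : ℝ} (hs : 0 < s) (α : ℝ) :
    (fun n : ℕ => ((n : ℝ) + 1) ^ (s + 1) * log ((n : ℝ) + 1) ^ (-α) -
      (n : ℝ) ^ (s + 1) * log n ^ (-α)) ~[atTop]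
      fun n : ℕ => (s + 1) * ((n : ℝ) ^ s * log n ^ (-α)) := by
  have hcast := tendsto_natCast_atTop_atTop (R := ℝ)
  have hex : ∀ n : ℕ, ∃ ξ : ℝ, (n : ℝ) ≤ ξ ∧ ξ ≤ n + 1 ∧ (2 ≤ n →
      ((n : ℝ) + 1) ^ (s + 1) * log ((n : ℝ) + 1) ^ (-α) - (n : ℝ) ^ (s + 1) * log n ^ (-α) =
        ξ ^ s * log ξ ^ (-α) * (s + 1 - α / log ξ)) := by
    intro n
    by_cases hn : 2 ≤ n
    · have hn1 : (1 : ℝ) < n := by exact_mod_cast hn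
      have hd : ∀ x ∈ Set.Icc (n : ℝ) (n + 1), HasDerivAt (fun x => x ^ (s + 1) * log x ^ (-α))
          (x ^ s * log x ^ (-α) * (s + 1 - α / log x)) x :=
        fun x hx => hasDerivAt_rpow_mul_log_rpow s α (hn1.trans_le hx.1)
      obtain ⟨ξ, hξ, h⟩ := exists_hasDerivAt_eq_slope
        (fun x => x ^ (s + 1) * log x ^ (-α)) _ (lt_add_one (n : ℝ))
        (fun x hx => (hd x hx).continuousAt.continuousWithinAt)
        (fun x hx => hd x (Set.Ioo_subset_Icc_self hx))
      refine ⟨ξ, hξ.1.le, hξ.2.le, fun _ => ?_⟩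
      rw [h]
      simp
    · exact ⟨n, le_rfl, by linarith, fun h => absurd h hn⟩
  choose ξ h1 h2 h3 using hex
  have hpos : ∀ᶠ n : ℕ in atTop, (0 : ℝ) < n := hcast.eventually_gt_atTop 0
  have hsucc : (fun n : ℕ => (n : ℝ) + 1) ~[atTop] fun n => (n : ℝ) := by
    have : (fun _ : ℕ => (1 : ℝ)) =o[atTop] fun n : ℕ => (n : ℝ) :=
      isLittleO_const_left.2 (Or.inr (tendsto_norm_atTop_atTop.comp hcast))
    refine this.congr_left fun x => ?_
    simp
  have hξ : ξ ~[atTop] fun n => (n : ℝ) := isEquivalent_of_le_of_le IsEquivalent.refl hsucc hpos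
    (Eventually.of_forall h1) (Eventually.of_forall h2)
  have hlog : (fun n => log (ξ n)) ~[atTop] fun n : ℕ => log n := hξ.log hcast
  have hlogpos : ∀ᶠ n : ℕ in atTop, (0 : ℝ) < log n :=
    (tendsto_log_atTop.comp hcast).eventually_gt_atTop 0
  have hfac : (fun n => s + 1 - α / log (ξ n)) ~[atTop] fun _ => s + 1 := by
    refine (isEquivalent_const_iff_tendsto (c := s + 1) (by positivity)).2 ?_
    have h4 : Tendsto (fun n => log (ξ n)) atTop atTop :=
      hlog.symm.tendsto_atTop (tendsto_log_atTop.comp hcast)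
    simpa using (h4.const_div_atTop α).const_sub (s + 1)
  have h5 := ((isEquivalent_rpow_const hξ hpos s).mul
    (isEquivalent_rpow_const hlog hlogpos (-α))).mul hfac
  refine (h5.congr_left ?_).congr_right ?_
  · filter_upwards [eventually_ge_atTop 2] with n hn
    rw [h3 n hn]
    rfl
  · refine Eventually.of_forall fun n => ?_
    simp only [Pi.mul_apply]
    ring

/-- Stolz–Cesàro: the increments of the claimed sum are equivalent to `u`, the partial sums diverge
since `u ≥ 1`, and the increments telescope. -/
lemma isEquivalent_sum_rpow_mul_log_rpow {s : ℝ} (hs : 0 < s) (α : ℝ) {C : ℝ} (hC : 0 < C)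
    {u : ℕ → ℝ} (hu1 : ∀ i, 1 ≤ u i)
    (hu : u ~[atTop] fun n : ℕ => C * ((n : ℝ) ^ s * log n ^ (-α))) :
    (fun m => ∑ i ∈ Finset.range m, u i) ~[atTop]
      fun m : ℕ => C / (s + 1) * ((m : ℝ) ^ (s + 1) * log m ^ (-α)) := by
  have hs1 : s + 1 ≠ 0 := by positivity
  set H : ℕ → ℝ := fun m => C / (s + 1) * ((m : ℝ) ^ (s + 1) * log m ^ (-α)) with hH
  have h1 : (fun n => H (n + 1) - H n) ~[atTop] u := by
    have h2 := (IsEquivalent.refl (u := fun _ : ℕ => C / (s + 1))).mul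
      (isEquivalent_diff_rpow_mul_log_rpow hs α)
    refine (h2.congr_left (Eventually.of_forall fun n => ?_)).trans (hu.symm.congr_left
      (Eventually.of_forall fun n => ?_))
    · simp only [hH, Pi.mul_apply]
      push_cast
      ring
    · simp only [Pi.mul_apply]
      field_simp
  have htop : Tendsto (fun m => ∑ i ∈ Finset.range m, u i) atTop atTop := by
    refine tendsto_atTop_mono (fun m => ?_) (tendsto_natCast_atTop_atTop (R := ℝ))
    simpa using Finset.card_nsmul_le_sum (Finset.range m) u 1 fun i _ => hu1 i
  have h3 := h1.isLittleO.sum_range (fun i => zero_le_one.trans (hu1 i)) htop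
  refine IsEquivalent.symm (h3.congr_left fun m => ?_)
  have h0 : H 0 = 0 := by simp [hH, zero_rpow hs1]
  simp only [Pi.sub_apply]
  rw [Finset.sum_sub_distrib, Finset.sum_range_sub, h0, sub_zero]

end Equivalents

/-! ### Enumeration of frequencies by increasing size -/

section Enumeration

open Asymptotics Real

/-- Repeatedly pick an unused element of least `P`; finite sublevel sets guarantee that one exists.
-/
lemma exists_greedy_enumeration {K : Type*} [Infinite K] (P : K → ℝ)
    (hfin : ∀ x, {k | P k ≤ x}.Finite) :
    ∃ v : ℕ → K, Function.Injective v ∧ ∀ i k, (∀ j < i, v j ≠ k) → P (v i) ≤ P k := by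
  classical
  have hpick : ∀ S : Finset K, ∃ k ∉ S, ∀ l ∉ S, P k ≤ P l := by
    intro S
    obtain ⟨k₀, hk₀⟩ := Infinite.exists_notMem_finset S
    obtain ⟨k, hk, hmin⟩ := Set.exists_min_image {k | P k ≤ P k₀ ∧ k ∉ S} P
      ((hfin (P k₀)).subset fun k hk => hk.1) ⟨k₀, le_rfl, hk₀⟩
    refine ⟨k, hk.2, fun l hl => ?_⟩
    rcases le_total (P l) (P k₀) with h | h
    · exact hmin l ⟨h, hl⟩
    · exact hk.1.trans h
  choose pick hp1 hp2 using hpick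
  let S : ℕ → Finset K := fun n => Nat.rec ∅ (fun _ T => insert (pick T) T) n
  have hS : ∀ i k, k ∈ S i ↔ ∃ j < i, pick (S j) = k := by
    intro i k
    induction i with
    | zero => simp [S]
    | succ i ih =>
      change k ∈ insert (pick (S i)) (S i) ↔ _
      rw [Finset.mem_insert, ih]
      constructor
      · rintro (rfl | ⟨j, hj, rfl⟩)
        · exact ⟨i, Nat.lt_succ_self i, rfl⟩
        · exact ⟨j, hj.trans (Nat.lt_succ_self i), rfl⟩
      · rintro ⟨j, hj, rfl⟩
        rcases Nat.lt_succ_iff_lt_or_eq.1 hj with h | rfl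
        · exact Or.inr ⟨j, h, rfl⟩
        · exact Or.inl rfl
  refine ⟨fun i => pick (S i), ?_, fun i k hk => hp2 _ _ fun h => ?_⟩
  · have hne : ∀ i j, i < j → pick (S i) ≠ pick (S j) := fun i j hij h =>
      hp1 (S j) ((hS j _).2 ⟨i, hij, h⟩)
    intro i j h
    rcases lt_trichotomy i j with hij | hij | hij
    · exact absurd h (hne i j hij)
    · exact hij
    · exact absurd h.symm (hne j i hij)
  · obtain ⟨j, hj, h⟩ := (hS i k).1 h
    exact hk j hj h

/-- The initial segments of a greedy enumeration have minimal weight. -/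
lemma sum_range_le_sum_of_greedy {K : Type*} {w : K → ℝ} {v : ℕ → K}
    (hv : Function.Injective v) (hg : ∀ i k, (∀ j < i, v j ≠ k) → w (v i) ≤ w k)
    (A : Finset K) : ∑ i ∈ Finset.range A.card, w (v i) ≤ ∑ k ∈ A, w k := by
  classical
  set B := (Finset.range A.card).image v with hB
  have hcard : B.card = A.card := by
    rw [hB, Finset.card_image_of_injective _ hv, Finset.card_range]
  rw [← Finset.sum_image (f := w) (fun i _ j _ h => hv h), ← hB,
    ← Finset.sum_sdiff (Finset.inter_subset_left : A ∩ B ⊆ A),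
    ← Finset.sum_sdiff (Finset.inter_subset_right : A ∩ B ⊆ B), Finset.sdiff_inter_self_left,
    Finset.sdiff_inter_self_right]
  gcongr ?_ + _
  -- With `A ∩ B` cancelled, two sets of equal size remain, and every element of `B \ A` was
  -- enumerated in preference to each element of `A \ B`.
  have hc : (B \ A).card = (A \ B).card := Finset.card_sdiff_comm hcard
  rcases (A \ B).eq_empty_or_nonempty with h | h
  · rw [h, Finset.card_empty, Finset.card_eq_zero] at hc
    rw [h, hc]
  · obtain ⟨k₀, hk₀, hmin⟩ := Finset.exists_min_image _ w h
    calc ∑ k ∈ B \ A, w k ≤ (B \ A).card • w k₀ := by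
          refine Finset.sum_le_card_nsmul _ _ _ fun k hk => ?_
          obtain ⟨i, hi, rfl⟩ := Finset.mem_image.1 (Finset.mem_sdiff.1 hk).1
          refine hg i k₀ fun j hj h => (Finset.mem_sdiff.1 hk₀).2 ?_
          rw [← h]
          exact Finset.mem_image_of_mem v
            (Finset.mem_range.2 (hj.trans (Finset.mem_range.1 hi)))
      _ = (A \ B).card • w k₀ := by rw [hc]
      _ ≤ _ := Finset.card_nsmul_le_sum _ _ _ hmin

variable {ρ : ℤ → ℝ}

/-- Asymptotics of the enumeration of `ℤ^(D+1)` by increasing product size. -/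
lemma IsSize.exists_enumeration (hρ : IsSize ρ) (D : ℕ) :
    ∃ v : ℕ → Fin (D + 1) → ℤ, Function.Injective v ∧
      (∀ i k, (∀ j < i, v j ≠ k) → prodSize ρ (v i) ≤ prodSize ρ k) ∧
      (fun i => prodSize ρ (v i)) ~[atTop]
        fun i : ℕ => (i : ℝ) / (2 ^ (D + 1) / (D.factorial : ℝ) * log i ^ D) := by
  classical
  have hfin : ∀ x, {k : Fin (D + 1) → ℤ | prodSize ρ k ≤ x}.Finite := fun x =>
    (hypCross ρ (D + 1) x).finite_toSet.subset fun k hk => hρ.mem_hypCross.2 hk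
  obtain ⟨v, hv, hg⟩ := exists_greedy_enumeration (prodSize ρ) hfin
  refine ⟨v, hv, hg, ?_⟩
  set x : ℕ → ℝ := fun i => prodSize ρ (v i)
  have hx : Tendsto x atTop atTop := by
    rw [tendsto_atTop]
    intro X
    have h1 := (hfin X).preimage hv.injOn
    have h2 : ∀ᶠ i in cofinite, i ∉ v ⁻¹' {k | prodSize ρ k ≤ X} := h1.eventually_cofinite_notMem
    rw [Nat.cofinite_eq_atTop] at h2
    exact h2.mono fun i hi => (not_le.1 hi).le
  have hmono : ∀ i j, i ≤ j → x i ≤ x j := fun i j hij =>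
    hg i (v j) fun l hl h => (hl.trans_le hij).ne (hv h)
  have hle : ∀ i : ℕ, (i : ℝ) ≤ (hypCross ρ (D + 1) (x i)).card := fun i => by
    have : (Finset.range i).image v ⊆ hypCross ρ (D + 1) (x i) := by
      intro k hk
      obtain ⟨j, hj, rfl⟩ := Finset.mem_image.1 hk
      exact hρ.mem_hypCross.2 (hmono j i (Finset.mem_range.1 hj).le)
    have h2 := Finset.card_le_card this
    rw [Finset.card_image_of_injective _ hv, Finset.card_range] at h2
    exact_mod_cast h2
  -- Ties prevent a bound on the cross at `x i` itself. At `x i - 1` all sizes are strictly smaller,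
  -- so every point was enumerated before `i`; the shift does not change the asymptotics.
  have hge : ∀ i : ℕ, ((hypCross ρ (D + 1) (x i - 1)).card : ℝ) ≤ i := fun i => by
    have : hypCross ρ (D + 1) (x i - 1) ⊆ (Finset.range i).image v := by
      intro k hk
      rw [hρ.mem_hypCross] at hk
      by_contra hk2
      have := hg i k fun j hj h => hk2 (h ▸ Finset.mem_image_of_mem v (Finset.mem_range.2 hj))
      change x i ≤ _ at this
      linarith
    have h2 := Finset.card_le_card this
    rw [Finset.card_image_of_injective _ hv, Finset.card_range] at h2
    exact_mod_cast h2
  have hc : (0 : ℝ) < 2 ^ (D + 1) / (D.factorial : ℝ) := by positivity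
  have hN := hρ.isEquivalent_card_hypCross D
  have h1 := hN.comp_tendsto hx
  have h2 := (hN.comp_tendsto (tendsto_atTop_add_const_right atTop (-1) tendsto_id)).trans
    ((IsEquivalent.refl (u := fun _ : ℝ => 2 ^ (D + 1) / (D.factorial : ℝ))).mul
      (isEquivalent_mul_log_pow_sub_one D))
  refine isEquivalent_of_natCast_isEquivalent hc D hx
    (isEquivalent_of_le_of_le (h2.comp_tendsto hx) h1 ?_
      (Eventually.of_forall hge) (Eventually.of_forall hle))
  filter_upwards [hx.eventually_gt_atTop 1] with i hi
  have hl : 0 < log (x i) := log_pos hi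
  have hxi : 0 < x i := by linarith
  positivity

end Enumeration

/-! ### Mixed weights and their minimal sums -/

section MixWeight

open Real Asymptotics

lemma isSize_max : IsSize fun k => max 1 |(k : ℝ)| where
  one_le _ := le_max_left _ _
  abs_cast_le _ := le_max_right _ _
  le_mul_add ε hε := ⟨1, fun k => by
    have : 0 ≤ ε * |(k : ℝ)| := by positivity
    refine max_le ?_ ?_ <;> nlinarith [abs_nonneg (k : ℝ)]⟩

lemma isSize_rpow {r : ℝ} (hr : 0 < r) : IsSize fun k => (1 + |(k : ℝ)| ^ r) ^ (1 / r) where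
  one_le k := one_le_rpow (by linarith [rpow_nonneg (abs_nonneg (k : ℝ)) r]) (by positivity)
  abs_cast_le k := by
    have h0 := abs_nonneg (k : ℝ)
    calc |(k : ℝ)| = (|(k : ℝ)| ^ r) ^ (1 / r) := by
          rw [← rpow_mul h0, mul_one_div_cancel hr.ne', rpow_one]
      _ ≤ _ := rpow_le_rpow (rpow_nonneg h0 r) (by linarith) (by positivity)
  le_mul_add ε hε := by
    have h1 : 0 < (1 + ε) ^ r - 1 := sub_pos.2 (one_lt_rpow (by linarith) hr)
    -- The threshold for `|k|^r` above which `1 + |k|^r ≤ (1 + ε)^r |k|^r`; below it the size is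
    -- bounded by a constant.
    set M := ((1 + ε) ^ r - 1)⁻¹
    refine ⟨(1 + M) ^ (1 / r), fun k => ?_⟩
    have h0 := abs_nonneg (k : ℝ)
    have h2 := rpow_nonneg h0 r
    rcases le_total (|(k : ℝ)| ^ r) M with h | h
    · calc (1 + |(k : ℝ)| ^ r) ^ (1 / r) ≤ (1 + M) ^ (1 / r) := by gcongr
        _ ≤ _ := by
          have : 0 ≤ (1 + ε) * |(k : ℝ)| := by positivity
          linarith
    · calc (1 + |(k : ℝ)| ^ r) ^ (1 / r) ≤ (((1 + ε) * |(k : ℝ)|) ^ r) ^ (1 / r) := by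
            gcongr
            rw [mul_rpow (by linarith) h0]
            have := (inv_le_iff_one_le_mul₀ h1).1 h
            nlinarith
        _ = (1 + ε) * |(k : ℝ)| := by
            rw [← rpow_mul (by positivity), mul_one_div_cancel hr.ne', rpow_one]
        _ ≤ _ := by
          have : 0 ≤ (1 + M) ^ (1 / r) := by positivity
          linarith

/-- The mixed weights are powers of product sizes. -/
lemma exists_isSize_mixWeight (s : ℝ) {r : ℝ≥0∞} (hr : 0 < r) :
    ∃ ρ : ℤ → ℝ, IsSize ρ ∧ ∀ (d : ℕ) (k : Fin d → ℤ), mixWeight s r k = prodSize ρ k ^ s := by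
  by_cases h : r = ∞
  · refine ⟨_, isSize_max, fun d k => ?_⟩
    rw [mixWeight, if_pos h, prodSize, ← Real.finsetProd_rpow _ _ fun i _ => by positivity]
  · have hr' : 0 < r.toReal := ENNReal.toReal_pos hr.ne' h
    refine ⟨_, isSize_rpow hr', fun d k => ?_⟩
    rw [mixWeight, if_neg h, prodSize, ← Real.finsetProd_rpow _ _ fun i _ => by positivity]
    refine Finset.prod_congr rfl fun i _ => ?_
    rw [← rpow_mul (by positivity)]
    congr 1
    ring

/-- The minimal weight of an `m`-element set of frequencies, with its asymptotics. -/
theorem exists_minimal_weight {s : ℝ} (hs : 0 < s) {r : ℝ≥0∞} (hr : 0 < r) (D : ℕ) :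
    (∀ k : Fin (D + 1) → ℤ, 1 ≤ mixWeight s r k) ∧
    ∃ W : ℕ → ℝ, (∀ A : Finset (Fin (D + 1) → ℤ), W A.card ≤ ∑ k ∈ A, mixWeight s r k) ∧
      (∀ m, ∃ A : Finset (Fin (D + 1) → ℤ), A.card = m ∧ ∑ k ∈ A, mixWeight s r k = W m) ∧
      (∀ m : ℕ, (m : ℝ) ≤ W m) ∧
      W ~[atTop] fun m : ℕ => ((2 ^ (D + 1) / (D.factorial : ℝ)) ^ s * (s + 1))⁻¹ *
        ((m : ℝ) ^ (s + 1) * log m ^ (-(s * D))) := by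
  classical
  obtain ⟨ρ, hρ, hw⟩ := exists_isSize_mixWeight s hr
  have hw1 : ∀ k : Fin (D + 1) → ℤ, 1 ≤ mixWeight s r k := fun k => by
    rw [hw]
    exact one_le_rpow (hρ.one_le_prodSize k) hs.le
  refine ⟨hw1, ?_⟩
  obtain ⟨v, hv, hg, hasymp⟩ := hρ.exists_enumeration D
  refine ⟨fun m => ∑ i ∈ Finset.range m, mixWeight s r (v i), fun A => ?_, fun m => ?_,
    fun m => ?_, ?_⟩
  · refine sum_range_le_sum_of_greedy hv (fun i k hk => ?_) A
    rw [hw, hw]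
    exact rpow_le_rpow (hρ.prodSize_pos _).le (hg i k hk) hs.le
  · refine ⟨(Finset.range m).image v, ?_, ?_⟩
    · rw [Finset.card_image_of_injective _ hv, Finset.card_range]
    · exact Finset.sum_image fun i _ j _ h => hv h
  · simpa using Finset.card_nsmul_le_sum (Finset.range m) (fun i => mixWeight s r (v i)) 1
      fun i _ => hw1 _
  · have hc : (0 : ℝ) < 2 ^ (D + 1) / (D.factorial : ℝ) := by positivity
    set c : ℝ := 2 ^ (D + 1) / (D.factorial : ℝ)
    have hcast := tendsto_natCast_atTop_atTop (R := ℝ)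
    have hlarge := hcast.eventually_gt_atTop 1
    have hu : (fun i => mixWeight s r (v i)) ~[atTop]
        fun n : ℕ => (c ^ s)⁻¹ * ((n : ℝ) ^ s * log n ^ (-(s * D))) := by
      have h1 := isEquivalent_rpow_const hasymp ?_ s
      · refine (h1.congr_left (Eventually.of_forall fun i => (hw _ _).symm)).congr_right ?_
        filter_upwards [hlarge] with n hn
        have hl : 0 < log (n : ℝ) := log_pos hn
        rw [div_rpow (by positivity) (by positivity), mul_rpow hc.le (by positivity),
          ← rpow_natCast, ← rpow_mul hl.le, rpow_neg hl.le, mul_comm s]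
        field_simp
      · filter_upwards [hlarge] with n hn
        have hl : 0 < log (n : ℝ) := log_pos hn
        positivity
    have h2 := isEquivalent_sum_rpow_mul_log_rpow hs (s * D) (C := (c ^ s)⁻¹) (by positivity)
      (fun i => hw1 (v i)) hu
    convert! h2 using 2 with m
    rw [mul_inv]
    ring

end MixWeight

/-! ### Optimisation over the number of frequencies -/

section Optimization

open Asymptotics Real

/-- The maximum of `(t - 1)^β / t^γ` over `t ≥ 1`. -/
noncomputable def maxConst (β γ : ℝ) : ℝ := β ^ β * (γ - β) ^ (γ - β) / γ ^ γ

/-- Weighted AM–GM for `(t - 1) / β` and `1 / (γ - β)`, with weights `β / γ` and `(γ - β) / γ`: the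
arithmetic mean is `t / γ`. -/
lemma rpow_sub_one_le {β γ t : ℝ} (hβ : 0 < β) (hγ : β < γ) (ht : 1 ≤ t) :
    (t - 1) ^ β ≤ maxConst β γ * t ^ γ := by
  have hγ0 : 0 < γ := hβ.trans hγ
  have hd : 0 < γ - β := sub_pos.2 hγ
  have ht1 : 0 ≤ t - 1 := by linarith
  have h := geom_mean_le_arith_mean2_weighted (w₁ := β / γ) (w₂ := (γ - β) / γ)
    (p₁ := (t - 1) / β) (p₂ := 1 / (γ - β)) (by positivity) (by positivity) (by positivity)
    (by positivity) (by field_simp; ring)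
  have h2 : β / γ * ((t - 1) / β) + (γ - β) / γ * (1 / (γ - β)) = t / γ := by
    field_simp
    ring
  rw [h2] at h
  have h3 := rpow_le_rpow (by positivity) h hγ0.le
  rw [mul_rpow (by positivity) (by positivity), ← rpow_mul (by positivity),
    ← rpow_mul (by positivity), div_mul_cancel₀ _ hγ0.ne', div_mul_cancel₀ _ hγ0.ne',
    div_rpow ht1 hβ.le, div_rpow zero_le_one hd.le, div_rpow (by linarith) hγ0.le, one_rpow] at h3
  have hb : 0 < β ^ β := by positivity
  have hdd : 0 < (γ - β) ^ (γ - β) := by positivity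
  calc (t - 1) ^ β = β ^ β * (γ - β) ^ (γ - β) *
        ((t - 1) ^ β / β ^ β * (1 / (γ - β) ^ (γ - β))) := by field_simp
    _ ≤ β ^ β * (γ - β) ^ (γ - β) * (t ^ γ / γ ^ γ) := by gcongr
    _ = _ := by rw [maxConst]; ring

lemma maxConst_pos {β γ : ℝ} (hβ : 0 < β) (hγ : β < γ) : 0 < maxConst β γ := by
  have hγ0 : 0 < γ := hβ.trans hγ
  have hd : 0 < γ - β := sub_pos.2 hγ
  rw [maxConst]
  positivity

lemma continuousAt_maxConst {β γ : ℝ} (hβ : 0 < β) (hγ : β < γ) :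
    ContinuousAt (maxConst β) γ := by
  have hγ0 : 0 < γ := hβ.trans hγ
  have hd : 0 < γ - β := sub_pos.2 hγ
  have h1 : ContinuousAt (fun x : ℝ => x - β) γ := by fun_prop
  exact (continuousAt_const.mul (h1.rpow h1 (Or.inl hd.ne'))).div
    (continuousAt_id.rpow continuousAt_id (Or.inl hγ0.ne')) (rpow_pos_of_pos hγ0 γ).ne'

/-- From `1 + u ≤ exp u` with `u = log t / log n`. It trades the logarithmic factor for a power of
`t` whose exponent tends to `0`. -/
lemma rpow_le_rpow_log_div_log {n t α : ℝ} (hn : 1 < n) (ht : 1 ≤ t) (hα : 0 ≤ α) :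
    (log (n * t) / log n) ^ α ≤ t ^ (α / log n) := by
  have hl : 0 < log n := log_pos hn
  have ht0 : 0 < t := by linarith
  have hlt : 0 ≤ log t := log_nonneg ht
  rw [log_mul (by linarith) ht0.ne', add_div, div_self hl.ne', rpow_def_of_pos ht0]
  have h1 : 1 + log t / log n ≤ exp (log t / log n) := by
    linarith [add_one_le_exp (log t / log n)]
  calc (1 + log t / log n) ^ α ≤ exp (log t / log n) ^ α := by gcongr
    _ = _ := by rw [← exp_mul]; congr 1; ring

/-- The bound holds for all `m ≥ n` at once: the ratio of logarithms is absorbed by lowering the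
exponent from `s + 1` to `s + 1 - α / log n`. Continuity of `maxConst β` recovers the sharp constant
as `n → ∞`. -/
lemma rpow_sub_le_maxConst {β s α n m : ℝ} (hβ : 0 < β) (hα : 0 ≤ α) (hn : 1 < n) (hm : n ≤ m)
    (hγ : β < s + 1 - α / log n) :
    (m - n) ^ β ≤ maxConst β (s + 1 - α / log n) * (n ^ (β - s - 1) * log n ^ α) *
      (m ^ (s + 1) * log m ^ (-α)) := by
  have hn0 : 0 < n := by linarith
  have hm0 : 0 < m := by linarith
  have hl : 0 < log n := log_pos hn
  have hlm : 0 < log m := log_pos (by linarith)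
  set γ := s + 1 - α / log n with hγd
  have ht : 1 ≤ m / n := (one_le_div hn0).2 hm
  have ht0 : 0 < m / n := by positivity
  have h1 := rpow_sub_one_le hβ hγ ht
  have h2 := rpow_le_rpow_log_div_log hn ht hα
  rw [mul_div_cancel₀ _ hn0.ne', div_rpow hlm.le hl.le] at h2
  have h3 : (m / n) ^ γ ≤ (m / n) ^ (s + 1) * (log n ^ α * log m ^ (-α)) := by
    rw [hγd, rpow_sub ht0, rpow_neg hlm.le]
    have h4 : 0 < log m ^ α := by positivity
    have h5 : 0 < log n ^ α := by positivity
    rw [div_eq_mul_inv]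
    gcongr
    rw [← div_eq_mul_inv, ← inv_div (log m ^ α)]
    exact inv_anti₀ (by positivity) h2
  have hM := maxConst_pos hβ hγ
  calc (m - n) ^ β = n ^ β * (m / n - 1) ^ β := by
        rw [← mul_rpow hn0.le (by linarith), mul_sub, mul_div_cancel₀ _ hn0.ne', mul_one]
    _ ≤ n ^ β * (maxConst β γ * ((m / n) ^ (s + 1) * (log n ^ α * log m ^ (-α)))) := by
        gcongr
        exact h1.trans (by gcongr)
    _ = _ := by
        rw [div_rpow hm0.le hn0.le, show β - s - 1 = β - (s + 1) by ring, rpow_sub hn0]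
        field_simp

lemma maxConst_eq {β s : ℝ} (hβ : 0 < β) (hβs : β < s + 1) :
    ((s + 1) / (s + 1 - β) - 1) ^ β / ((s + 1) / (s + 1 - β)) ^ (s + 1) =
      maxConst β (s + 1) := by
  have hd : 0 < s + 1 - β := sub_pos.2 hβs
  have hs : 0 < s + 1 := hβ.trans hβs
  have h1 : (s + 1) / (s + 1 - β) - 1 = β / (s + 1 - β) := by
    field_simp
    ring
  rw [h1, maxConst, div_rpow hβ.le hd.le, div_rpow hs.le hd.le, rpow_sub hd (s + 1) β]
  field_simp

/-- The asymptotic behaviour of `sup_{m > n} (m - n)^β / W m`. -/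
theorem tendsto_of_width_bounds {β s α q : ℝ} (hβ : 0 < β) (hβ1 : β ≤ 1) (hs : 0 < s) (hα : 0 ≤ α)
    (hq : 0 < q) {W : ℕ → ℝ} (hW : ∀ m : ℕ, (m : ℝ) ≤ W m)
    (hWa : W ~[atTop] fun m : ℕ => q * ((m : ℝ) ^ (s + 1) * log m ^ (-α)))
    {σ : ℕ → ℝ≥0∞}
    (hU : ∀ (n : ℕ) (R : ℝ), 0 ≤ R → (∀ m : ℕ, n < m → ((m : ℝ) - n) ^ β ≤ R * W m) →
      σ n ≤ ENNReal.ofReal R)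
    (hL : ∀ n m : ℕ, n ≤ m → 0 < m → ENNReal.ofReal (((m : ℝ) - n) ^ β / W m) ≤ σ n) :
    (∀ n, σ n ≠ ∞) ∧
      Tendsto (fun n : ℕ => (σ n).toReal / ((n : ℝ) ^ (β - s - 1) * log n ^ α)) atTop
        (𝓝 (maxConst β (s + 1) / q)) := by
  have hβs : β < s + 1 := by linarith
  -- The crude choice `R = 1` works: `(m - n)^β ≤ m - n ≤ m ≤ W m`.
  have hfin : ∀ n, σ n ≠ ∞ := fun n => by
    refine ne_top_of_le_ne_top ENNReal.ofReal_ne_top (hU n 1 zero_le_one fun m hm => ?_)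
    have h1 : (1 : ℝ) ≤ (m : ℝ) - n := by
      rw [← Nat.cast_sub hm.le]
      exact_mod_cast Nat.sub_pos_of_lt hm
    calc ((m : ℝ) - n) ^ β ≤ ((m : ℝ) - n) ^ (1 : ℝ) := rpow_le_rpow_of_exponent_le h1 hβ1
      _ ≤ m := by
        rw [rpow_one]
        linarith [Nat.cast_nonneg (α := ℝ) n]
      _ ≤ 1 * W m := by rw [one_mul]; exact hW m
  refine ⟨hfin, ?_⟩
  have hcast := tendsto_natCast_atTop_atTop (R := ℝ)
  have hlog : Tendsto (fun n : ℕ => log (n : ℝ)) atTop atTop := tendsto_log_atTop.comp hcast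
  have hM := maxConst_pos hβ hβs
  have hγ : Tendsto (fun n : ℕ => s + 1 - α / log (n : ℝ)) atTop (𝓝 (s + 1)) := by
    simpa using (hlog.const_div_atTop α).const_sub (s + 1)
  rw [tendsto_order]
  constructor
  · intro a ha
    -- The maximiser of `(t - 1)^β / t^(s + 1)`; testing `m = ⌊l n⌋` attains the constant in the
    -- limit, by `maxConst_eq`.
    set l := (s + 1) / (s + 1 - β) with hl
    have hd : 0 < s + 1 - β := sub_pos.2 hβs
    have hl1 : 1 < l := (one_lt_div hd).2 (by linarith)
    have hl0 : 0 < l := by linarith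
    set m : ℕ → ℕ := fun n => ⌊l * n⌋₊ with hm
    have hln : Tendsto (fun n : ℕ => l * (n : ℝ)) atTop atTop := hcast.const_mul_atTop hl0
    have hmtop : Tendsto m atTop atTop := tendsto_nat_floor_atTop.comp hln
    have hmeq : (fun n => (m n : ℝ)) ~[atTop] fun n : ℕ => l * (n : ℝ) :=
      (isEquivalent_nat_floor (R := ℝ)).comp_tendsto hln
    have hmn : (fun n => (m n : ℝ) - n) ~[atTop] fun n : ℕ => (l - 1) * (n : ℝ) := by
      have h1 : (fun n : ℕ => l * (n : ℝ)) =O[atTop] fun n : ℕ => (l - 1) * (n : ℝ) :=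
        ((isBigO_const_mul_self l (fun n : ℕ => (n : ℝ)) atTop)).trans
          (isBigO_self_const_mul (sub_pos.2 hl1).ne' _ _)
      refine (hmeq.isLittleO.trans_isBigO h1).congr_left fun n => ?_
      simp only [Pi.sub_apply]
      ring
    have hpos : ∀ᶠ n : ℕ in atTop, (0 : ℝ) < n := hcast.eventually_gt_atTop 0
    have hlogpos : ∀ᶠ n : ℕ in atTop, (0 : ℝ) < log n := hlog.eventually_gt_atTop 0
    have hlogm : (fun n => log (m n)) ~[atTop] fun n : ℕ => log n := by
      refine (hmeq.log hln).trans ?_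
      have h1 : (fun _ : ℕ => log l) =o[atTop] fun n : ℕ => log (n : ℝ) :=
        isLittleO_const_left.2 (Or.inr (tendsto_norm_atTop_atTop.comp hlog))
      refine h1.congr' ?_ EventuallyEq.rfl
      filter_upwards [hpos] with n hn
      rw [Pi.sub_apply, log_mul hl0.ne' hn.ne']
      ring
    have hnum := isEquivalent_rpow_const hmn
      (hpos.mono fun n hn => mul_pos (sub_pos.2 hl1) hn) β
    have hden := (hWa.comp_tendsto hmtop).trans
      ((IsEquivalent.refl (u := fun _ : ℕ => q)).mul
        ((isEquivalent_rpow_const hmeq (hpos.mono fun n hn => mul_pos hl0 hn) (s + 1)).mul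
          (isEquivalent_rpow_const hlogm hlogpos (-α))))
    have hlim : Tendsto (fun n : ℕ => ((m n : ℝ) - n) ^ β / W (m n) /
        ((n : ℝ) ^ (β - s - 1) * log n ^ α)) atTop (𝓝 (maxConst β (s + 1) / q)) := by
      have h1 := (hnum.div hden).div (IsEquivalent.refl
        (u := fun n : ℕ => (n : ℝ) ^ (β - s - 1) * log n ^ α))
      refine (h1.tendsto_nhds_iff).2 (tendsto_const_nhds.congr' ?_)
      filter_upwards [hpos, hlogpos] with n hn hln
      simp only [Pi.div_apply, Pi.mul_apply]
      rw [← maxConst_eq hβ hβs, ← hl, mul_rpow (sub_pos.2 hl1).le hn.le, mul_rpow hl0.le hn.le,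
        show β - s - 1 = β - (s + 1) by ring, rpow_sub hn, rpow_neg hln.le]
      have : 0 < (n : ℝ) ^ β := by positivity
      have : 0 < (n : ℝ) ^ (s + 1) := by positivity
      have : 0 < log (n : ℝ) ^ α := by positivity
      have : 0 < l ^ (s + 1) := by positivity
      field_simp
    filter_upwards [hlim.eventually_const_lt ha, hpos, hlogpos] with n hn hn0 hln0
    refine hn.trans_le ?_
    have hnm : n ≤ m n := Nat.le_floor (by nlinarith)
    have hn1 : 0 < n := by exact_mod_cast hn0
    gcongr
    exact (ENNReal.ofReal_le_iff_le_toReal (hfin n)).1 (hL n (m n) hnm (hn1.trans_le hnm))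
  · intro b hb
    -- Leaves room for the relative error in `W m ≥ (1 - η) q m^(s+1) (log m)^(-α)`, valid for all
    -- `m > n` once `n` is large.
    obtain ⟨η, hη0, hη1, hη⟩ : ∃ η : ℝ, 0 < η ∧ η < 1 ∧
        maxConst β (s + 1) / (q * (1 - η)) < b := by
      have h1 : Tendsto (fun η : ℝ => maxConst β (s + 1) / (q * (1 - η))) (𝓝[>] 0)
          (𝓝 (maxConst β (s + 1) / q)) := by
        have : ContinuousAt (fun η : ℝ => maxConst β (s + 1) / (q * (1 - η))) 0 := by
          refine continuousAt_const.div (by fun_prop) ?_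
          simpa using hq.ne'
        simpa using this.tendsto.mono_left nhdsWithin_le_nhds
      have h2 : ∀ᶠ η : ℝ in 𝓝[>] 0, η < 1 :=
        (eventually_lt_nhds zero_lt_one).filter_mono nhdsWithin_le_nhds
      obtain ⟨η, h3, h4, h5⟩ := ((h1.eventually_lt_const hb).and
        (h2.and self_mem_nhdsWithin)).exists
      exact ⟨η, h5, h4, h3⟩
    have hη' : 0 < 1 - η := by linarith
    have hlim : Tendsto (fun n : ℕ => maxConst β (s + 1 - α / log n) / (q * (1 - η))) atTop
        (𝓝 (maxConst β (s + 1) / (q * (1 - η)))) :=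
      (((continuousAt_maxConst hβ hβs).tendsto.comp hγ)).div_const _
    obtain ⟨N, hN⟩ := eventually_atTop.1 (hWa.isLittleO.bound hη0)
    filter_upwards [hlim.eventually_lt_const hη, hcast.eventually_gt_atTop 1,
      hγ.eventually_const_lt hβs, eventually_ge_atTop N] with n hn hn1 hnγ hnN
    have hn0 : (0 : ℝ) < n := by linarith
    have hln : 0 < log (n : ℝ) := log_pos hn1
    refine lt_of_le_of_lt ?_ hn
    have hMn := maxConst_pos hβ hnγ
    rw [div_le_iff₀ (by positivity)]
    refine ENNReal.toReal_le_of_le_ofReal (by positivity) (hU n _ (by positivity) fun m hm => ?_)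
    have hnm : (n : ℝ) ≤ m := by exact_mod_cast hm.le
    have hlm : 0 < log (m : ℝ) := log_pos (by linarith)
    have hm0 : (0 : ℝ) < m := by linarith
    have h1 := hN m (hnN.trans hm.le)
    rw [Pi.sub_apply, Real.norm_eq_abs, Real.norm_of_nonneg (by positivity)] at h1
    have h2 : (1 - η) * (q * ((m : ℝ) ^ (s + 1) * log m ^ (-α))) ≤ W m := by
      have := (abs_le.1 h1).1
      linarith
    calc ((m : ℝ) - n) ^ β ≤ maxConst β (s + 1 - α / log n) *
          ((n : ℝ) ^ (β - s - 1) * log n ^ α) * ((m : ℝ) ^ (s + 1) * log m ^ (-α)) :=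
          rpow_sub_le_maxConst hβ hα hn1 hnm hnγ
      _ = maxConst β (s + 1 - α / log n) / (q * (1 - η)) *
          ((n : ℝ) ^ (β - s - 1) * log n ^ α) *
          ((1 - η) * (q * ((m : ℝ) ^ (s + 1) * log m ^ (-α)))) := by
          field_simp
      _ ≤ _ := by gcongr

end Optimization

/-- Asymptotic constants of the widths, for target norms that are `ℓ_p` norms of the Fourier
coefficients. -/
theorem tendsto_nTermWidth {D : ℕ} {s : ℝ} (hs : 0 < s) {r : ℝ≥0∞} (hr : 0 < r) {p : ℝ≥0∞}
    (hp : 1 ≤ p) (hp' : p ≠ ∞) {normY : L1 (D + 1) → ℝ≥0∞}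
    (hY : ∀ f : L1 (D + 1), (Summable fun k => ‖fourierCoeffTorus f k‖) →
      normY f = eLpNorm (fourierCoeffTorus f) p Measure.count) :
    (∀ n, nTermWidth (normAmix s r) normY (trigSystem (D + 1)) n ≠ ∞) ∧
      Tendsto (fun n : ℕ => (nTermWidth (normAmix s r) normY (trigSystem (D + 1)) n).toReal /
        ((n : ℝ) ^ (1 / p.toReal - s - 1) * Real.log n ^ (s * D))) atTop
        (𝓝 (maxConst (1 / p.toReal) (s + 1) * (s + 1) *
          ((2 : ℝ) ^ (D + 1) / (D.factorial : ℝ)) ^ s)) := by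
  obtain ⟨hw, W, hW, hWA, hWm, hWa⟩ := exists_minimal_weight hs hr D
  have hp1 : 1 ≤ p.toReal := by
    rw [← ENNReal.toReal_one]
    exact ENNReal.toReal_mono hp' hp
  have h := tendsto_of_width_bounds (β := 1 / p.toReal) (by positivity)
    ((div_le_one (by linarith)).2 hp1) hs (by positivity) (by positivity) hWm hWa
    (σ := nTermWidth (normAmix s r) normY (trigSystem (D + 1)))
    (fun n R hR h => nTermWidth_le hp hp' hY hw hW hR h) fun n m hnm hm => by
      obtain ⟨A, hA, hAW⟩ := hWA m
      have := le_nTermWidth hp hp' hY hw (n := n) (A := A) (by omega)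
        (Finset.card_pos.1 (by omega))
      rwa [hA, hAW] at this
  refine ⟨h.1, ?_⟩
  convert! h.2 using 2
  field_simp

end MixWiener

theorem theorem4p3 (d : ℕ) (hd : 1 ≤ d) (s : ℝ) (hs : 0 < s) (r : ℝ≥0∞) (hr : 0 < r) :
    ((∀ n : ℕ, MixWiener.nTermWidth (MixWiener.normAmix s r) MixWiener.normL2
        (MixWiener.trigSystem d) n ≠ ∞) ∧
      Tendsto (fun n : ℕ =>
          (MixWiener.nTermWidth (MixWiener.normAmix s r) MixWiener.normL2
            (MixWiener.trigSystem d) n).toReal /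
          ((n : ℝ) ^ (-s - 1 / 2) * Real.log n ^ (s * ((d : ℝ) - 1))))
        atTop
        (𝓝 ((s + 1 / 2) ^ (s + 1 / 2) / (√2 * (s + 1) ^ s) *
          ((2 : ℝ) ^ d / (Nat.factorial (d - 1) : ℝ)) ^ s))) ∧
    ((∀ n : ℕ, MixWiener.nTermWidth (MixWiener.normAmix s r) MixWiener.normA
        (MixWiener.trigSystem d) n ≠ ∞) ∧
      Tendsto (fun n : ℕ =>
          (MixWiener.nTermWidth (MixWiener.normAmix s r) MixWiener.normA
            (MixWiener.trigSystem d) n).toReal /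
          ((n : ℝ) ^ (-s) * Real.log n ^ (s * ((d : ℝ) - 1))))
        atTop
        (𝓝 (s ^ s / (s + 1) ^ s *
          ((2 : ℝ) ^ d / (Nat.factorial (d - 1) : ℝ)) ^ s))) := by
  -- With `d = D + 1`, the natural subtraction in `(d - 1)!` and the real one in the exponent both
  -- become `D`.
  obtain ⟨D, rfl⟩ : ∃ D, d = D + 1 := ⟨d - 1, by omega⟩
  have hs1 : s + 1 ≠ 0 := by positivity
  have h2 := MixWiener.tendsto_nTermWidth (D := D) hs hr (p := 2) one_le_two ENNReal.ofNat_ne_top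
    fun f hf => MixWiener.normL2_eq_eLpNorm_count hf
  have h1 := MixWiener.tendsto_nTermWidth (D := D) hs hr (p := 1) le_rfl ENNReal.one_ne_top
    fun f _ => MixWiener.normA_eq_eLpNorm_count f
  have hD : ((D + 1 : ℕ) : ℝ) - 1 = D := by push_cast; ring
  have he2 : (1 / (2 : ℝ≥0∞).toReal - s - 1 : ℝ) = -s - 1 / 2 := by
    rw [ENNReal.toReal_ofNat]; ring
  have he1 : (1 / (1 : ℝ≥0∞).toReal - s - 1 : ℝ) = -s := by
    rw [ENNReal.toReal_one]; ring
  have hc2 : MixWiener.maxConst (1 / (2 : ℝ≥0∞).toReal) (s + 1) * (s + 1) =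
      (s + 1 / 2) ^ (s + 1 / 2) / (√2 * (s + 1) ^ s) := by
    rw [ENNReal.toReal_ofNat, MixWiener.maxConst, show s + 1 - 1 / 2 = s + 1 / 2 by ring,
      Real.rpow_add_one hs1, ← Real.sqrt_eq_rpow, Real.sqrt_div zero_le_one, Real.sqrt_one]
    field_simp
  have hc1 : MixWiener.maxConst (1 / (1 : ℝ≥0∞).toReal) (s + 1) * (s + 1) =
      s ^ s / (s + 1) ^ s := by
    rw [ENNReal.toReal_one, MixWiener.maxConst, show s + 1 - 1 / 1 = s by ring,
      Real.rpow_add_one hs1, div_one, Real.one_rpow]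
    field_simp
  rw [he2, hc2] at h2
  rw [he1, hc1] at h1
  rw [hD, Nat.add_sub_cancel]
  exact ⟨h2, h1⟩
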